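/- **Setting.** Let $X$ be an infinite-dimensional Banach space that is the dual $X=Z^*$ of a separable Banach space $Z$, and let $Y$ be a Banach space. Let $G:X\to X$ be a bounded linear injective operator with unbounded inverse which is the adjoint of a bounded operator $\tilde G:Z\to Z$ and is of positive type: there is $\kappa_*>0$ such that for every $\beta>0$ the operator $G+\beta I$ is bijective with $\|(G+\beta I)^{-1}\|\le\kappa_*/\beta$. Define $G^0=I$, $G^pu=\frac{\sin\pi p}{\pi}\int_0^\infty s^{p-1}(G+sI)^{-1}Gu\,ds$ for $0<p<1$, $G^p=G^{p-\lfloor p\rfloor}G^{\lfloor p\rfloor}$ for $p\ge1$, and $G^{-p}=(G^p)^{-1}$ on $\mathcal R(G^p)$ for $p>0$. Put $X_\tau=\mathcal R(G^\tau)$ for $\tau>0$, $X_\tau=X$ for $\tau\le0$, and $\|u\|_\tau=\|G^{-\tau}u\|$ for $u\in X_\tau$. Let $D(\log G)$ be the set of all $u\in X$ for which $\lim_{p\downarrow0}\frac1p(G^pu-u)$ exists. Let $F:D(F)\subset X\to Y$ be weak$^*$-to-weak sequentially continuous on a weak$^*$ sequentially closed set $D(F)$, let $u^\dagger$ be an interior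 point of $D(F)$ with $F(u^\dagger)=f^\dagger$, let $\bar u\in X_1\cap D(F)$, and let $a>0$. Assume that there are constants $0<c_a\le c_b$ and $c_0,c_1>0$ such that for all $u\in D(F)\cap X_1$: - if $\|u-u^\dagger\|_{-a}\le c_0$, then $\|F(u)-f^\dagger\|\le c_b\|u-u^\dagger\|_{-a}$; - if $\|F(u)-f^\dagger\|\le c_1$, then $c_a\|u-u^\dagger\|_{-a}\le\|F(u)-f^\dagger\|$. Let $r>0$ and $\kappa=\frac1{r(a+1)}$. For $\alpha>0$ and $f^\delta\in Y$ with $\|f^\delta-f^\dagger\|\le\delta$, let $u_\alpha^\delta$ denote any minimizer over $D(F)$ of $T_\alpha^\delta(u)=\|F(u)-f^\delta\|^r+\alpha\|u-\bar u\|_1^r$ (with value $+\infty$ for $u\notin X_1$). Write $\alpha(\delta)\sim g(\delta)$ if $c\,g(\delta)\le\alpha(\delta)\le C\,g(\delta)$ for all sufficiently small $\delta>0$, with constants $0<c\le C$. **Theorem.** Let $\alpha_*=\alpha(\delta)>0$, $\delta>0$, be an a priori parameter choice. The following convergence and rates as $\delta\to0$ hold uniformly over all data $f^\delta$ with $\|f^\delta-f^\dagger\|\le\delta$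 and all minimizers $u_{\alpha_*}^\delta$. 1. If $u^\dagger\in\overline{\mathcal R(G)}$, $\alpha(\delta)\to0$ and $\delta/\alpha(\delta)^{\kappa a}\to0$ as $\delta\to0$, then $\|u_{\alpha_*}^\delta-u^\dagger\|\to0$. 2. If $u^\dagger\in X_p$ for some $0<p\le1$ and $\alpha(\delta)\sim\delta^{1/(\kappa(p+a))}$, then $\|u_{\alpha_*}^\delta-u^\dagger\|=O(\delta^{p/(p+a)})$. 3. If $u^\dagger\in D(\log G)$, $r>\frac a{a+1}$ (equivalently $\kappa a<1$), and $\alpha(\delta)\sim\delta$, then $\|u_{\alpha_*}^\delta-u^\dagger\|=O\bigl(1/\log\frac1\delta\bigr)$. -/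

import Mathlib

open Filter Topology Asymptotics

namespace Oversmoothing

noncomputable section

/-- The operator `G` is of positive type: for every `β > 0` the operator `G + β I` is one-to-one and
onto, and `‖(G + β I)⁻¹‖ ≤ κ / β` with a finite constant `κ > 0`. (On a Banach space the bijective
operator `G + β I` is a unit of the ring of bounded operators and `Ring.inverse` is its inverse.) -/
def IsPositiveType {X : Type*} [NormedAddCommGroup X] [NormedSpace ℝ X] (G : X →L[ℝ] X) : Prop :=
  ∃ κ : ℝ, 0 < κ ∧ ∀ β : ℝ, 0 < β →
    Function.Bijective (G + β • (1 : X →L[ℝ] X)) ∧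
      ‖Ring.inverse (G + β • (1 : X →L[ℝ] X))‖ ≤ κ / β

/-- The Balakrishnan integral
`G ^ p u = (sin (π p) / π) ∫₀^∞ s ^ (p - 1) (G + s I)⁻¹ G u ds`, meant for `0 < p < 1`. -/
def balakrishnan {X : Type*} [NormedAddCommGroup X] [NormedSpace ℝ X] (G : X →L[ℝ] X)
    (p : ℝ) (u : X) : X :=
  (Real.sin (Real.pi * p) / Real.pi) •
    ∫ s in Set.Ioi (0 : ℝ), s ^ (p - 1) • Ring.inverse (G + s • (1 : X →L[ℝ] X)) (G u)

/-- The powers `G ^ p` with exponent `p ≥ 0`: `G ^ 0 = I`, the Balakrishnan integral for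
`0 < p < 1`, and `G ^ p = G ^ (p - ⌊p⌋) G ^ ⌊p⌋` in general. -/
def nonnegPow {X : Type*} [NormedAddCommGroup X] [NormedSpace ℝ X] (G : X →L[ℝ] X)
    (p : ℝ) (u : X) : X :=
  if Int.fract p = 0 then (G ^ ⌊p⌋₊) u else balakrishnan G (Int.fract p) ((G ^ ⌊p⌋₊) u)

/-- The powers `G ^ p` for real `p`; for `p < 0`, `G ^ p` is the inverse of the one-to-one map
`G ^ (-p)`, and it is meant to be applied on the range of `G ^ (-p)` only. -/
def fracPow {X : Type*} [NormedAddCommGroup X] [NormedSpace ℝ X] (G : X →L[ℝ] X)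
    (p : ℝ) : X → X :=
  if 0 ≤ p then nonnegPow G p else Function.invFun (nonnegPow G (-p))

/-- The spaces `X_τ` of the scale generated by `G`: the range of `G ^ τ` for `τ > 0`, and the whole
of `X` for `τ ≤ 0`. -/
def scaleSpace {X : Type*} [NormedAddCommGroup X] [NormedSpace ℝ X] (G : X →L[ℝ] X)
    (τ : ℝ) : Set X :=
  if 0 < τ then Set.range (fracPow G τ) else Set.univ

/-- The norm `‖u‖_τ = ‖G ^ (-τ) u‖` for `u ∈ X_τ`. -/
def scaleNorm {X : Type*} [NormedAddCommGroup X] [NormedSpace ℝ X] (G : X →L[ℝ] X)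
    (τ : ℝ) (u : X) : ℝ :=
  ‖fracPow G (-τ) u‖

/-- The domain of `log G`, the infinitesimal generator of `(G ^ p)_{p ≥ 0}`: the elements `u` for
which `(G ^ p u - u) / p` has a limit as `p ↓ 0`. -/
def logDomain {X : Type*} [NormedAddCommGroup X] [NormedSpace ℝ X] (G : X →L[ℝ] X) : Set X :=
  {u | ∃ l : X, Tendsto (fun p : ℝ => p⁻¹ • (fracPow G p u - u)) (𝓝[>] 0) (𝓝 l)}

/-- Weak* convergence of a sequence in `X`, where `X` is identified with the dual of `Z`. -/
def WeakStarTendsto {X Z : Type*} [NormedAddCommGroup X] [NormedSpace ℝ X]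
    [NormedAddCommGroup Z] [NormedSpace ℝ Z] (e : X ≃ₗᵢ[ℝ] StrongDual ℝ Z)
    (u : ℕ → X) (u₀ : X) : Prop :=
  ∀ z : Z, Tendsto (fun n => e (u n) z) atTop (𝓝 (e u₀ z))

/-- Weak convergence of a sequence in `Y`. -/
def WeakTendsto {Y : Type*} [NormedAddCommGroup Y] [NormedSpace ℝ Y]
    (y : ℕ → Y) (y₀ : Y) : Prop :=
  ∀ φ : StrongDual ℝ Y, Tendsto (fun n => φ (y n)) atTop (𝓝 (φ y₀))

/-- The penalty `Ω(u) = ‖u - ubar‖₁ ^ r` for `u ∈ X₁`, and `Ω(u) = ∞` otherwise. -/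
def penalty {X : Type*} [NormedAddCommGroup X] [NormedSpace ℝ X] (G : X →L[ℝ] X)
    (ubar : X) (r : ℝ) (u : X) : ENNReal :=
  open Classical in
  if u ∈ scaleSpace G 1 then ENNReal.ofReal (scaleNorm G 1 (u - ubar) ^ r) else ⊤

/-- The Tikhonov functional `‖F u - f‖ ^ r + α Ω(u)`. -/
def tikhonov {X Y : Type*} [NormedAddCommGroup X] [NormedSpace ℝ X] [NormedAddCommGroup Y]
    (G : X →L[ℝ] X) (F : X → Y) (ubar : X) (r α : ℝ) (f : Y) (u : X) : ENNReal :=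
  ENNReal.ofReal (‖F u - f‖ ^ r) + ENNReal.ofReal α * penalty G ubar r u

/-- `u` is a regularized solution: it minimizes the Tikhonov functional over the domain `DF`. -/
def IsRegularizedSolution {X Y : Type*} [NormedAddCommGroup X] [NormedSpace ℝ X]
    [NormedAddCommGroup Y] (G : X →L[ℝ] X) (F : X → Y) (DF : Set X) (ubar : X) (r α : ℝ)
    (f : Y) (u : X) : Prop :=
  u ∈ DF ∧ ∀ v ∈ DF, tikhonov G F ubar r α f u ≤ tikhonov G F ubar r α f v

/-- The exponent `κ = 1 / (r (a + 1))`. -/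
def kappa (r a : ℝ) : ℝ := 1 / (r * (a + 1))

/-- The standing assumptions on `X = Z*`, on the generator `G`, on the operator `F` with domain
`DF` (only the values of `F` on `DF` matter), on the solution `ust` of `F u = fst`, on the initial
guess `ubar` and on the degree `a` of ill-posedness. -/
structure MainAssumption {X Y Z : Type*} [NormedAddCommGroup X] [NormedSpace ℝ X]
    [NormedAddCommGroup Y] [NormedSpace ℝ Y] [NormedAddCommGroup Z] [NormedSpace ℝ Z]
    (e : X ≃ₗᵢ[ℝ] StrongDual ℝ Z) (G : X →L[ℝ] X) (F : X → Y) (DF : Set X)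
    (ust : X) (fst : Y) (ubar : X) (a : ℝ) : Prop where
  infinite_dimensional : ¬ FiniteDimensional ℝ X
  injective : Function.Injective G
  unbounded_inverse : ¬ ∃ C : ℝ, ∀ w : X, ‖w‖ ≤ C * ‖G w‖
  positive_type : IsPositiveType G
  weak_continuous : ∀ (u : ℕ → X) (u₀ : X), (∀ n, u n ∈ DF) → u₀ ∈ DF →
    WeakStarTendsto e u u₀ → WeakTendsto (fun n => F (u n)) (F u₀)
  weak_closed : ∀ (u : ℕ → X) (u₀ : X), (∀ n, u n ∈ DF) → WeakStarTendsto e u u₀ → u₀ ∈ DF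
  nonempty : (DF ∩ scaleSpace G 1).Nonempty
  solution : F ust = fst
  solution_interior : ust ∈ interior DF
  guess_mem : ubar ∈ scaleSpace G 1 ∩ DF
  a_pos : 0 < a
  nonlinearity : ∃ ca cb c₀ c₁ : ℝ, 0 < ca ∧ ca ≤ cb ∧ 0 < c₀ ∧ 0 < c₁ ∧
    (∀ u ∈ DF ∩ scaleSpace G 1, scaleNorm G (-a) (u - ust) ≤ c₀ →
      ‖F u - fst‖ ≤ cb * scaleNorm G (-a) (u - ust)) ∧
    (∀ u ∈ DF ∩ scaleSpace G 1, ‖F u - fst‖ ≤ c₁ →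
      ca * scaleNorm G (-a) (u - ust) ≤ ‖F u - fst‖)
  preadjoint : ∃ Gt : Z →L[ℝ] Z, ∀ (u : X) (z : Z), e (G u) z = e u (Gt z)

end

end Oversmoothing

open Oversmoothing

/-!
Write `A β = G (G + β I)⁻¹` (`approx`) and `R β = β (G + β I)⁻¹ = I - A β` (`residual`), and let
`w = ust - ubar`. Everything is controlled by the single function `ψ β = ‖R β w‖`.

* The minimizer is compared with `uhat = ust - R β ^ (m + 1) w`, where `m` is an integer exceeding
  the degree `a` of ill-posedness and `β = α ^ κ`. This element lies in `X₁`, and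
  `‖uhat - ust‖ ≲ ψ`, `‖uhat - ust‖₋ₐ ≲ β ^ a ψ`, `‖uhat - ubar‖₁ ≲ β⁻¹ ψ`. As
  `α = β ^ (r (a + 1))`, both terms of the Tikhonov functional at `uhat` are of the order of
  `(β ^ a ψ + δ) ^ r`; minimality and the two nonlinearity bounds transfer this to the regularized
  solution `u`, and `‖u - uhat‖₋ₐ ≲ β ^ a ψ + δ`, `‖u - uhat‖₁ ≲ (β ^ a ψ + δ) / β ^ (a + 1)`.
* The interpolation inequality `‖v‖ ≲ β ‖v‖₁ + β ^ (-a) ‖v‖₋ₐ`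
  (`PositiveTypeWith.norm_apply_le_interpolation`) then gives `‖u - ust‖ ≲ ψ β + δ β ^ (-a)`
  (`MainAssumption.exists_error_le`), as soon as `ψ β → 0` for `β → 0`.
* The three claims follow from the behaviour of `ψ`: it tends to zero on the closure of the range
  of `G`, is `O(β ^ p)` on `X_p`, `p ≤ 1`, and `O(1 / log (1 / β))` on the domain of `log G`. The last bound
  comes from splitting the Balakrishnan integral of `R β (G ^ p u)` at `s = β` and choosing `p` of
  the order of `1 / log (1 / β)`.

For non-integer `a` the interpolation inequality needs the law of exponents
`G ^ (1 - θ) G ^ θ = c G` with some `c > 0`, where `θ` is the fractional part of `a`. It is proved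
in `PositiveTypeWith.exists_powIntegral_mul_powIntegral` for the operator-valued Balakrishnan
integrals, by Fubini's theorem and a Frullani integral for `∫₀^∞ A(x) A(τ x) dx`. The exact value of
`c` is not needed.
-/

namespace Oversmoothing

open MeasureTheory Set

/-! ### The scalar kernel `s ^ (q - 1) * min 1 (β / s)` -/

section Kernel

variable {q β : ℝ}

lemma integrableOn_kernel_Ioc (hq : 0 < q) (hβ : 0 < β) :
    IntegrableOn (fun s : ℝ => s ^ (q - 1) * min 1 (β / s)) (Ioc 0 β) ∧
      ∫ s in Ioc 0 β, s ^ (q - 1) * min 1 (β / s) = β ^ q / q := by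
  have heq : EqOn (fun s : ℝ => s ^ (q - 1)) (fun s : ℝ => s ^ (q - 1) * min 1 (β / s))
      (Ioc 0 β) := by
    intro s hs
    have : 1 ≤ β / s := (one_le_div hs.1).2 hs.2
    simp [min_eq_left this]
  have hint : IntegrableOn (fun s : ℝ => s ^ (q - 1)) (Ioc 0 β) :=
    (intervalIntegrable_iff_integrableOn_Ioc_of_le hβ.le).1
      (intervalIntegral.intervalIntegrable_rpow' (by linarith))
  refine ⟨hint.congr_fun heq measurableSet_Ioc, ?_⟩
  rw [← setIntegral_congr_fun measurableSet_Ioc heq, ← intervalIntegral.integral_of_le hβ.le,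
    integral_rpow (Or.inl (by linarith))]
  simp [Real.zero_rpow hq.ne']

lemma integrableOn_kernel_Ioi (hq : q < 1) (hβ : 0 < β) :
    IntegrableOn (fun s : ℝ => s ^ (q - 1) * min 1 (β / s)) (Ioi β) ∧
      ∫ s in Ioi β, s ^ (q - 1) * min 1 (β / s) = β ^ q / (1 - q) := by
  have heq : EqOn (fun s : ℝ => β * s ^ (q - 2)) (fun s : ℝ => s ^ (q - 1) * min 1 (β / s))
      (Ioi β) := by
    intro s hs
    have hs' : β < s := hs
    have hs0 : 0 < s := hβ.trans hs'
    have : β / s ≤ 1 := (div_le_one hs0).2 hs'.le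
    have h2 : s ^ (q - 2) = s ^ (q - 1) / s := by
      rw [← Real.rpow_sub_one hs0.ne']; ring_nf
    simp only [min_eq_right this, h2]
    ring
  have hint : IntegrableOn (fun s : ℝ => β * s ^ (q - 2)) (Ioi β) :=
    (integrableOn_Ioi_rpow_of_lt (by linarith) hβ).const_mul β
  refine ⟨hint.congr_fun heq measurableSet_Ioi, ?_⟩
  rw [← setIntegral_congr_fun measurableSet_Ioi heq, integral_const_mul,
    integral_Ioi_rpow_of_lt (by linarith) hβ]
  have h3 : β ^ (q - 2 + 1) = β ^ q / β := by
    rw [← Real.rpow_sub_one hβ.ne']; ring_nf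
  rw [h3]
  have : q - 2 + 1 ≠ 0 := by linarith
  have : 1 - q ≠ 0 := by linarith
  field_simp
  ring

lemma integrableOn_kernel (hq : 0 < q) (hq1 : q < 1) (hβ : 0 < β) :
    IntegrableOn (fun s : ℝ => s ^ (q - 1) * min 1 (β / s)) (Ioi 0) := by
  rw [← Ioc_union_Ioi_eq_Ioi hβ.le]
  exact (integrableOn_kernel_Ioc hq hβ).1.union (integrableOn_kernel_Ioi hq1 hβ).1

lemma integral_kernel (hq : 0 < q) (hq1 : q < 1) (hβ : 0 < β) :
    ∫ s in Ioi 0, s ^ (q - 1) * min 1 (β / s) = (1 / q + 1 / (1 - q)) * β ^ q := by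
  rw [← Ioc_union_Ioi_eq_Ioi hβ.le, setIntegral_union (Ioc_disjoint_Ioi le_rfl) measurableSet_Ioi
    (integrableOn_kernel_Ioc hq hβ).1 (integrableOn_kernel_Ioi hq1 hβ).1,
    (integrableOn_kernel_Ioc hq hβ).2, (integrableOn_kernel_Ioi hq1 hβ).2]
  ring

end Kernel

/-! ### Resolvents of an operator of positive type -/

section Resolvent

variable {X : Type*} [NormedAddCommGroup X] [NormedSpace ℝ X]

/-- The operator `(G + s I)⁻¹`; it is a genuine inverse for `s > 0` if `G` is of positive type. -/
noncomputable def res (G : X →L[ℝ] X) (s : ℝ) : X →L[ℝ] X :=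
  Ring.inverse (G + s • (1 : X →L[ℝ] X))

/-- The bounded approximation `G (G + s I)⁻¹` of the identity, as `s → 0`. -/
noncomputable def approx (G : X →L[ℝ] X) (s : ℝ) : X →L[ℝ] X := G * res G s

/-- The residual operator `s (G + s I)⁻¹ = I - G (G + s I)⁻¹` of Lavrentiev's method. -/
noncomputable def residual (G : X →L[ℝ] X) (s : ℝ) : X →L[ℝ] X := s • res G s

/-- Positive type with a fixed constant `κ`, bijectivity being expressed as invertibility in the
algebra of bounded operators. -/
structure PositiveTypeWith (G : X →L[ℝ] X) (κ : ℝ) : Prop where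
  pos : 0 < κ
  isUnit : ∀ s : ℝ, 0 < s → IsUnit (G + s • (1 : X →L[ℝ] X))
  norm_res : ∀ s : ℝ, 0 < s → ‖res G s‖ ≤ κ / s

lemma IsPositiveType.exists_with [CompleteSpace X] {G : X →L[ℝ] X} (h : IsPositiveType G) :
    ∃ κ, PositiveTypeWith G κ := by
  obtain ⟨κ, hκ, h⟩ := h
  exact ⟨κ, hκ, fun s hs => ContinuousLinearMap.isUnit_iff_bijective.2 (h s hs).1,
    fun s hs => (h s hs).2⟩

namespace PositiveTypeWith

variable {G : X →L[ℝ] X} {κ s t : ℝ}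

lemma mul_res (h : PositiveTypeWith G κ) (hs : 0 < s) :
    (G + s • (1 : X →L[ℝ] X)) * res G s = 1 :=
  Ring.mul_inverse_cancel _ (h.isUnit s hs)

lemma res_mul (h : PositiveTypeWith G κ) (hs : 0 < s) :
    res G s * (G + s • (1 : X →L[ℝ] X)) = 1 :=
  Ring.inverse_mul_cancel _ (h.isUnit s hs)

lemma approx_add_residual (h : PositiveTypeWith G κ) (hs : 0 < s) :
    approx G s + residual G s = 1 := by
  have := h.mul_res hs
  rwa [add_mul, smul_mul_assoc, one_mul] at this

lemma approx_eq (h : PositiveTypeWith G κ) (hs : 0 < s) : approx G s = 1 - residual G s :=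
  eq_sub_of_add_eq (h.approx_add_residual hs)

lemma commute_res {T : X →L[ℝ] X} (hT : Commute T G) (s : ℝ) : Commute T (res G s) := by
  have hT' : Commute T (G + s • (1 : X →L[ℝ] X)) :=
    hT.add_right ((Commute.one_right T).smul_right s)
  by_cases hu : IsUnit (G + s • (1 : X →L[ℝ] X))
  · obtain ⟨v, hv⟩ := hu
    rw [res, ← hv, Ring.inverse_unit]
    rw [← hv] at hT'
    exact hT'.units_inv_right
  · rw [res, Ring.inverse_non_unit _ hu]
    exact Commute.zero_right T

lemma commute_residual {T : X →L[ℝ] X} (hT : Commute T G) (s : ℝ) : Commute T (residual G s) :=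
  (commute_res hT s).smul_right s

lemma commute_approx {T : X →L[ℝ] X} (hT : Commute T G) (s : ℝ) : Commute T (approx G s) :=
  hT.mul_right (commute_res hT s)

lemma residual_commute (s : ℝ) : Commute (residual G s) G :=
  (commute_residual (Commute.refl G) s).symm

lemma approx_commute (s : ℝ) : Commute (approx G s) G :=
  (commute_approx (Commute.refl G) s).symm

lemma norm_residual_le (h : PositiveTypeWith G κ) (hs : 0 < s) : ‖residual G s‖ ≤ κ := by
  rw [residual, norm_smul, Real.norm_of_nonneg hs.le]
  calc s * ‖res G s‖ ≤ s * (κ / s) := by gcongr; exact h.norm_res s hs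
    _ = κ := by field_simp

lemma norm_approx_le (h : PositiveTypeWith G κ) (hs : 0 < s) : ‖approx G s‖ ≤ 1 + κ := by
  rw [h.approx_eq hs]
  exact (norm_sub_le _ _).trans
    (add_le_add ContinuousLinearMap.norm_id_le (h.norm_residual_le hs))

lemma norm_approx_le_min (h : PositiveTypeWith G κ) (hs : 0 < s) :
    ‖approx G s‖ ≤ (1 + κ + ‖G‖ * κ) * min 1 (1 / s) := by
  have hκ := h.pos
  have hG := norm_nonneg G
  have h1 : ‖approx G s‖ ≤ ‖G‖ * (κ / s) :=
    (norm_mul_le _ _).trans (mul_le_mul_of_nonneg_left (h.norm_res s hs) hG)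
  rw [mul_min_of_nonneg _ _ (by positivity)]
  refine le_min ((h.norm_approx_le hs).trans ?_) (h1.trans ?_)
  · nlinarith [mul_nonneg hG hκ.le]
  · rw [← mul_div_assoc, mul_one_div]
    gcongr
    linarith

lemma approx_mul_residual (hs : 0 < s) :
    approx G s * residual G t = (t / s) • (approx G t * residual G s) := by
  have hc : res G s * res G t = res G t * res G s :=
    commute_res (commute_res (Commute.refl G) s).symm t
  simp only [approx, residual, mul_smul_comm, smul_smul, mul_assoc, hc]
  congr 1
  field_simp

lemma norm_approx_mul_residual_le (h : PositiveTypeWith G κ) (hs : 0 < s) (ht : 0 < t) :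
    ‖approx G s * residual G t‖ ≤ (1 + κ) * κ * min 1 (t / s) := by
  have hκ := h.pos
  have key : ∀ {x y : ℝ}, 0 < x → 0 < y → ‖approx G x * residual G y‖ ≤ (1 + κ) * κ :=
    fun hx hy => (norm_mul_le _ _).trans
      (mul_le_mul (h.norm_approx_le hx) (h.norm_residual_le hy) (norm_nonneg _) (by linarith))
  rw [mul_min_of_nonneg _ _ (by positivity), mul_one]
  refine le_min (key hs ht) ?_
  rw [approx_mul_residual hs, norm_smul, Real.norm_of_nonneg (by positivity), mul_comm]
  exact mul_le_mul_of_nonneg_right (key ht hs) (by positivity)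

lemma norm_mul_residual_le (h : PositiveTypeWith G κ) (hs : 0 < s) :
    ‖G * residual G s‖ ≤ (1 + κ) * s := by
  rw [residual, mul_smul_comm, norm_smul, Real.norm_of_nonneg hs.le, mul_comm]
  exact mul_le_mul_of_nonneg_right (h.norm_approx_le hs) hs.le

lemma continuousOn_res [CompleteSpace X] (h : PositiveTypeWith G κ) :
    ContinuousOn (res G) (Ioi 0) := by
  intro s hs
  obtain ⟨v, hv⟩ := h.isUnit s hs
  have h1 : ContinuousAt Ring.inverse (G + s • (1 : X →L[ℝ] X)) :=
    hv ▸ NormedRing.inverse_continuousAt v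
  have h2 : ContinuousAt (fun s : ℝ => G + s • (1 : X →L[ℝ] X)) s := by fun_prop
  exact (ContinuousAt.comp (f := fun s : ℝ => G + s • (1 : X →L[ℝ] X)) h1 h2).continuousWithinAt

lemma continuousOn_approx [CompleteSpace X] (h : PositiveTypeWith G κ) :
    ContinuousOn (approx G) (Ioi 0) :=
  continuousOn_const.mul h.continuousOn_res

lemma integrableOn_approx [CompleteSpace X] (h : PositiveTypeWith G κ) {q : ℝ}
    (hq : 0 < q) (hq1 : q < 1) :
    IntegrableOn (fun s : ℝ => s ^ (q - 1) • approx G s) (Ioi 0) := by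
  refine Integrable.mono' ((integrableOn_kernel hq hq1 one_pos).const_mul (1 + κ + ‖G‖ * κ)) ?_ ?_
  · have hc : ContinuousOn (fun s : ℝ => s ^ (q - 1)) (Ioi 0) := fun s hs =>
      (Real.continuousAt_rpow_const s _ (Or.inl (ne_of_gt hs))).continuousWithinAt
    exact (hc.smul h.continuousOn_approx).aestronglyMeasurable measurableSet_Ioi
  · filter_upwards [ae_restrict_mem measurableSet_Ioi] with s hs
    have hs' : (0 : ℝ) < s := hs
    rw [norm_smul, Real.norm_of_nonneg (by positivity)]
    calc s ^ (q - 1) * ‖approx G s‖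
        ≤ s ^ (q - 1) * ((1 + κ + ‖G‖ * κ) * min 1 (1 / s)) := by
          gcongr; exact h.norm_approx_le_min hs'
      _ = _ := by ring

/-- If `T` tames `approx G s` like the kernel `min 1 (β / s)`, then it tames the Balakrishnan
integral of order `q` like `β ^ q`. -/
lemma norm_integral_mul_le {T : X →L[ℝ] X} {q β D : ℝ} (hq : 0 < q) (hq1 : q < 1) (hβ : 0 < β)
    (hT : ∀ s : ℝ, 0 < s → ‖approx G s * T‖ ≤ D * min 1 (β / s)) :
    ‖∫ s in Ioi (0 : ℝ), (s ^ (q - 1) • approx G s) * T‖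
      ≤ D * (1 / q + 1 / (1 - q)) * β ^ q := by
  rw [mul_assoc, ← integral_kernel hq hq1 hβ, ← integral_const_mul]
  refine norm_integral_le_of_norm_le ((integrableOn_kernel hq hq1 hβ).const_mul D) ?_
  filter_upwards [ae_restrict_mem measurableSet_Ioi] with s hs
  have hs' : (0 : ℝ) < s := hs
  rw [smul_mul_assoc, norm_smul, Real.norm_of_nonneg (by positivity)]
  calc s ^ (q - 1) * ‖approx G s * T‖ ≤ s ^ (q - 1) * (D * min 1 (β / s)) := by
        gcongr; exact hT s hs'
    _ = _ := by ring

end PositiveTypeWith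

/-- The operator-valued integral `∫₀^∞ s ^ (q - 1) G (G + s I)⁻¹ ds`, a positive multiple of `G ^ q`
for `0 < q < 1`. -/
noncomputable def powIntegral (G : X →L[ℝ] X) (q : ℝ) : X →L[ℝ] X :=
  ∫ s in Ioi (0 : ℝ), s ^ (q - 1) • approx G s

namespace PositiveTypeWith

variable {G : X →L[ℝ] X} {κ : ℝ}

lemma powIntegral_mul [CompleteSpace X] (h : PositiveTypeWith G κ) {q : ℝ}
    (hq : 0 < q) (hq1 : q < 1) (T : X →L[ℝ] X) :
    powIntegral G q * T = ∫ s in Ioi (0 : ℝ), (s ^ (q - 1) • approx G s) * T :=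
  (integral_mul_const_of_integrable (h.integrableOn_approx hq hq1)).symm

lemma commute_powIntegral [CompleteSpace X] (h : PositiveTypeWith G κ) {q : ℝ}
    (hq : 0 < q) (hq1 : q < 1) {T : X →L[ℝ] X} (hT : Commute T G) :
    Commute T (powIntegral G q) := by
  rw [Commute, SemiconjBy, h.powIntegral_mul hq hq1, powIntegral,
    ← integral_const_mul_of_integrable (h.integrableOn_approx hq hq1)]
  refine integral_congr_ae (Eventually.of_forall fun s => ?_)
  exact ((commute_approx hT s).smul_right _)

lemma norm_powIntegral_mul_residual_le [CompleteSpace X] (h : PositiveTypeWith G κ) {q β : ℝ}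
    (hq : 0 < q) (hq1 : q < 1) (hβ : 0 < β) :
    ‖powIntegral G q * residual G β‖ ≤ (1 + κ) * κ * (1 / q + 1 / (1 - q)) * β ^ q := by
  rw [h.powIntegral_mul hq hq1]
  exact norm_integral_mul_le hq hq1 hβ fun s hs => h.norm_approx_mul_residual_le hs hβ

lemma balakrishnan_eq [CompleteSpace X] (h : PositiveTypeWith G κ) {q : ℝ}
    (hq : 0 < q) (hq1 : q < 1) (u : X) :
    balakrishnan G q u = (Real.sin (Real.pi * q) / Real.pi) • powIntegral G q u := by
  rw [balakrishnan, powIntegral, ContinuousLinearMap.integral_apply (h.integrableOn_approx hq hq1)]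
  congr 1
  refine integral_congr_ae (Eventually.of_forall fun s => ?_)
  have : G * res G s = res G s * G := commute_res (Commute.refl G) s
  simp only [_root_.smul_apply, approx, this]
  rfl

end PositiveTypeWith
end Resolvent

/-! ### The product of two complementary fractional powers -/

section Product

variable {X : Type*} [NormedAddCommGroup X] [NormedSpace ℝ X]

namespace PositiveTypeWith

variable {G : X →L[ℝ] X} {κ s t : ℝ}

lemma smul_approx (h : PositiveTypeWith G κ) (hs : 0 < s) :
    s • approx G s = G - approx G s * G := by
  have h1 : approx G s * (G + s • (1 : X →L[ℝ] X)) = G := by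
    rw [approx, mul_assoc, h.res_mul hs, mul_one]
  rw [mul_add, mul_smul_comm, mul_one] at h1
  exact eq_sub_of_add_eq' h1

lemma smul_approx_mul_approx (h : PositiveTypeWith G κ) (hs : 0 < s) (ht : 0 < t) :
    (t - s) • (approx G s * approx G t) = t • approx G t - s • approx G s := by
  have hc : approx G s * approx G t = approx G t * approx G s :=
    commute_approx (approx_commute s) t
  have h1 : t • (approx G s * approx G t) = approx G s * G - approx G s * (approx G t * G) := by
    rw [← mul_smul_comm, h.smul_approx ht, mul_sub]
  have h2 : s • (approx G s * approx G t) = approx G t * G - approx G s * (approx G t * G) := by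
    rw [hc, ← mul_smul_comm, h.smul_approx hs, mul_sub, ← mul_assoc (approx G s), hc, mul_assoc]
  rw [sub_smul, h1, h2, h.smul_approx hs, h.smul_approx ht]
  abel

lemma norm_approx_sub_le (h : PositiveTypeWith G κ) (hs : 0 < s) :
    ‖approx G s - s⁻¹ • G‖ ≤ ‖G‖ ^ 2 * κ / s ^ 2 := by
  have h1 : approx G s - s⁻¹ • G = -(s⁻¹ • (approx G s * G)) := by
    have : approx G s = s⁻¹ • (G - approx G s * G) := by
      rw [← h.smul_approx hs, smul_smul, inv_mul_cancel₀ hs.ne', one_smul]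
    conv_lhs => rw [this]
    rw [smul_sub]; abel
  have h2 : ‖approx G s‖ ≤ ‖G‖ * (κ / s) :=
    (norm_mul_le _ _).trans (mul_le_mul_of_nonneg_left (h.norm_res s hs) (norm_nonneg _))
  rw [h1, norm_neg, norm_smul, Real.norm_of_nonneg (by positivity)]
  calc s⁻¹ * ‖approx G s * G‖ ≤ s⁻¹ * (‖G‖ * (κ / s) * ‖G‖) := by
        gcongr
        exact (norm_mul_le _ _).trans (mul_le_mul_of_nonneg_right h2 (norm_nonneg _))
    _ = _ := by field_simp

lemma intervalIntegrable_approx [CompleteSpace X] (h : PositiveTypeWith G κ)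
    (hs : 0 < s) (ht : 0 < t) : IntervalIntegrable (approx G) volume s t :=
  (h.continuousOn_approx.mono fun _ hx => (lt_min hs ht).trans_le hx.1).intervalIntegrable

lemma hasDerivAt_integral_approx [CompleteSpace X] (h : PositiveTypeWith G κ) (hs : 0 < s) :
    HasDerivAt (fun x => ∫ y in (1 : ℝ)..x, approx G y) (approx G s) s :=
  intervalIntegral.integral_hasDerivAt_right (h.intervalIntegrable_approx one_pos hs)
    (h.continuousOn_approx.stronglyMeasurableAtFilter isOpen_Ioi s hs)
    (h.continuousOn_approx.continuousAt (Ioi_mem_nhds hs))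

/-- A Frullani integral: `(τ - 1) A(x) A(x τ)` is the derivative of `∫_x^{x τ} A(y) dy`, where
`A(y) = G (G + y I)⁻¹` is bounded near `0` and close to `y⁻¹ G` at infinity. -/
lemma integral_approx_mul_approx [CompleteSpace X] (h : PositiveTypeWith G κ) {τ : ℝ}
    (hτ : 0 < τ) (hτ1 : τ ≠ 1)
    (hint : IntegrableOn (fun x => approx G x * approx G (x * τ)) (Ioi 0)) :
    ∫ x in Ioi (0 : ℝ), approx G x * approx G (x * τ) = (Real.log τ / (τ - 1)) • G := by
  have hτ' : τ - 1 ≠ 0 := sub_ne_zero.2 hτ1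
  set Φ : ℝ → X →L[ℝ] X := fun x => ∫ y in (1 : ℝ)..x, approx G y with hΦ
  set f : ℝ → X →L[ℝ] X := fun x => (τ - 1)⁻¹ • (Φ (x * τ) - Φ x) with hf
  have hf_eq : ∀ x, 0 < x → f x = (τ - 1)⁻¹ • ∫ y in x..(x * τ), approx G y := by
    intro x hx
    simp only [hf, hΦ]
    rw [intervalIntegral.integral_interval_sub_left
      (h.intervalIntegrable_approx one_pos (by positivity))
      (h.intervalIntegrable_approx one_pos hx)]
  have hpos : ∀ {x y : ℝ}, 0 < x → y ∈ uIoc x (x * τ) → min 1 τ * x ≤ y := by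
    intro x y hx hy
    rw [uIoc, mem_Ioc] at hy
    refine le_trans (le_of_eq ?_) hy.1.le
    rw [min_mul_of_nonneg _ _ hx.le, one_mul, mul_comm]
  have hm : 0 < min 1 τ := lt_min one_pos hτ
  have hf0 : f 0 = 0 := by simp [hf]
  have hcont : ContinuousWithinAt f (Ici 0) 0 := by
    rw [ContinuousWithinAt, hf0]
    refine squeeze_zero_norm' (a := fun x => (1 + κ) * x) ?_ ?_
    · filter_upwards [self_mem_nhdsWithin] with x hx
      rcases (show (0 : ℝ) ≤ x from hx).eq_or_lt with rfl | hx
      · simp [hf0]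
      · rw [hf_eq x hx, norm_smul]
        have h1 : ‖∫ y in x..(x * τ), approx G y‖ ≤ (1 + κ) * |x * τ - x| :=
          intervalIntegral.norm_integral_le_of_norm_le_const fun y hy =>
            h.norm_approx_le ((mul_pos hm hx).trans_le (hpos hx hy))
        have h2 : |x * τ - x| = x * |τ - 1| := by
          rw [show x * τ - x = x * (τ - 1) by ring, abs_mul, abs_of_pos hx]
        rw [h2] at h1
        calc ‖(τ - 1)⁻¹‖ * ‖∫ y in x..(x * τ), approx G y‖
            ≤ |τ - 1|⁻¹ * ((1 + κ) * (x * |τ - 1|)) := by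
              rw [norm_inv, Real.norm_eq_abs]; gcongr
          _ = (1 + κ) * x := by
              have := abs_pos.2 hτ'
              field_simp
    · have : Tendsto (fun x : ℝ => (1 + κ) * x) (𝓝 0) (𝓝 ((1 + κ) * 0)) := by
        exact tendsto_id.const_mul _
      rw [mul_zero] at this
      exact this.mono_left nhdsWithin_le_nhds
  have hderiv : ∀ x ∈ Ioi (0 : ℝ), HasDerivAt f (approx G x * approx G (x * τ)) x := by
    intro x hx
    have hx : 0 < x := hx
    have h1 : HasDerivAt (fun x : ℝ => Φ (x * τ)) (τ • approx G (x * τ)) x := by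
      have h2 : HasDerivAt (fun x : ℝ => x * τ) τ x := by
        simpa using (hasDerivAt_id x).mul_const τ
      exact (h.hasDerivAt_integral_approx (by positivity : 0 < x * τ)).scomp x h2
    have h3 := (h1.sub (h.hasDerivAt_integral_approx hx)).const_smul (τ - 1)⁻¹
    have h4 : approx G x * approx G (x * τ) = (τ - 1)⁻¹ • (τ • approx G (x * τ) - approx G x) := by
      have h5 := h.smul_approx_mul_approx hx (by positivity : 0 < x * τ)
      have h6 : x • ((τ - 1) • (approx G x * approx G (x * τ))) =
          x • (τ • approx G (x * τ) - approx G x) := by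
        rw [smul_smul, smul_sub, smul_smul, ← h5]; congr 1; ring
      rw [← smul_right_injective _ hx.ne' h6, smul_smul, inv_mul_cancel₀ hτ', one_smul]
    rw [h4]
    exact h3
  have hlim : Tendsto f atTop (𝓝 ((Real.log τ / (τ - 1)) • G)) := by
    rw [tendsto_iff_norm_sub_tendsto_zero]
    refine squeeze_zero' (Eventually.of_forall fun _ => norm_nonneg _)
      (g := fun x => ‖G‖ ^ 2 * κ / (min 1 τ) ^ 2 * x⁻¹) ?_ ?_
    · filter_upwards [eventually_gt_atTop 0] with x hx
      have hlog : ∫ y in x..(x * τ), y⁻¹ • G = Real.log τ • G := by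
        rw [intervalIntegral.integral_smul_const, integral_inv_of_pos hx (by positivity)]
        congr 2
        field_simp
      have hii : IntervalIntegrable (fun y : ℝ => y⁻¹ • G) volume x (x * τ) := by
        refine ContinuousOn.intervalIntegrable ?_
        have : ContinuousOn (fun y : ℝ => y⁻¹) (uIcc x (x * τ)) :=
          continuousOn_inv₀.mono fun y hy =>
            ne_of_gt ((lt_min hx (by positivity : 0 < x * τ)).trans_le hy.1)
        exact this.smul continuousOn_const
      have h1 : f x - (Real.log τ / (τ - 1)) • G =
          (τ - 1)⁻¹ • ∫ y in x..(x * τ), (approx G y - y⁻¹ • G) := by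
        rw [intervalIntegral.integral_sub (h.intervalIntegrable_approx hx (by positivity)) hii,
          hlog, hf_eq x hx, smul_sub, smul_smul, div_eq_inv_mul]
      have h2 : ‖∫ y in x..(x * τ), (approx G y - y⁻¹ • G)‖
          ≤ ‖G‖ ^ 2 * κ / (min 1 τ * x) ^ 2 * |x * τ - x| := by
        refine intervalIntegral.norm_integral_le_of_norm_le_const fun y hy => ?_
        have hy' := hpos hx hy
        have hmx := mul_pos hm hx
        have hκ := h.pos
        refine (h.norm_approx_sub_le (hmx.trans_le hy')).trans ?_
        gcongr
      have h3 : |x * τ - x| = x * |τ - 1| := by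
        rw [show x * τ - x = x * (τ - 1) by ring, abs_mul, abs_of_pos hx]
      rw [h3] at h2
      rw [h1, norm_smul, norm_inv, Real.norm_eq_abs]
      have hτa := abs_pos.2 hτ'
      calc |τ - 1|⁻¹ * ‖∫ y in x..(x * τ), (approx G y - y⁻¹ • G)‖
          ≤ |τ - 1|⁻¹ * (‖G‖ ^ 2 * κ / (min 1 τ * x) ^ 2 * (x * |τ - 1|)) := by gcongr
        _ = ‖G‖ ^ 2 * κ / (min 1 τ) ^ 2 * x⁻¹ := by
            field_simp
    · simpa using tendsto_inv_atTop_zero.const_mul (‖G‖ ^ 2 * κ / (min 1 τ) ^ 2)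
  rw [integral_Ioi_of_hasDerivAt_of_tendsto hcont hderiv hint hlim, hf0, sub_zero]

lemma integrable_prod_approx [CompleteSpace X] (h : PositiveTypeWith G κ) {θ : ℝ}
    (hθ : 0 < θ) (hθ1 : θ < 1) :
    Integrable (Function.uncurry fun x τ : ℝ => τ ^ (θ - 1) • (approx G x * approx G (x * τ)))
      ((volume.restrict (Ioi 0)).prod (volume.restrict (Ioi 0))) := by
  have hmeas : AEStronglyMeasurable
      (Function.uncurry fun x τ : ℝ => τ ^ (θ - 1) • (approx G x * approx G (x * τ)))
      ((volume.restrict (Ioi 0)).prod (volume.restrict (Ioi 0))) := by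
    rw [Measure.prod_restrict]
    refine ContinuousOn.aestronglyMeasurable ?_ (measurableSet_Ioi.prod measurableSet_Ioi)
    have h1 : ContinuousOn (fun z : ℝ × ℝ => z.2 ^ (θ - 1)) (Ioi 0 ×ˢ Ioi 0) :=
      continuousOn_snd.rpow_const fun z hz => Or.inl (ne_of_gt hz.2)
    have h2 : ContinuousOn (fun z : ℝ × ℝ => approx G z.1) (Ioi 0 ×ˢ Ioi 0) :=
      h.continuousOn_approx.comp continuousOn_fst fun z hz => hz.1
    have h3 : ContinuousOn (fun z : ℝ × ℝ => approx G (z.1 * z.2)) (Ioi 0 ×ˢ Ioi 0) :=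
      h.continuousOn_approx.comp (continuousOn_fst.mul continuousOn_snd)
        fun z hz => mul_pos (mem_Ioi.1 hz.1) (mem_Ioi.1 hz.2)
    exact h1.smul (h2.mul h3)
  set D : ℝ := 1 + κ + ‖G‖ * κ with hD
  have hD0 : 0 ≤ D := by
    have := h.pos
    positivity
  have hbound : ∀ x τ : ℝ, 0 < x → 0 < τ →
      ‖τ ^ (θ - 1) • (approx G x * approx G (x * τ))‖
        ≤ D * D * min 1 (1 / x) * (τ ^ (θ - 1) * min 1 (1 / x / τ)) := by
    intro x τ hx hτ
    rw [norm_smul, Real.norm_of_nonneg (by positivity), div_div]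
    calc τ ^ (θ - 1) * ‖approx G x * approx G (x * τ)‖
        ≤ τ ^ (θ - 1) * ((D * min 1 (1 / x)) * (D * min 1 (1 / (x * τ)))) := by
          gcongr
          exact (norm_mul_le _ _).trans (mul_le_mul (h.norm_approx_le_min hx)
            (h.norm_approx_le_min (by positivity)) (norm_nonneg _) (by positivity))
      _ = _ := by ring
  refine (integrable_prod_iff hmeas).2 ⟨?_, ?_⟩
  · filter_upwards [hmeas.prodMk_left, ae_restrict_mem measurableSet_Ioi] with x hx1 hx
    have hx : 0 < x := hx
    refine Integrable.mono' ((integrableOn_kernel hθ hθ1 (by positivity : 0 < 1 / x)).const_mul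
      (D * D * min 1 (1 / x))) hx1 ?_
    filter_upwards [ae_restrict_mem measurableSet_Ioi] with τ hτ
    exact hbound x τ hx hτ
  · refine Integrable.mono' ((integrableOn_kernel (q := 1 - θ) (by linarith) (by linarith)
      one_pos).const_mul (D * D * (1 / θ + 1 / (1 - θ)))) hmeas.norm.integral_prod_right' ?_
    filter_upwards [ae_restrict_mem measurableSet_Ioi] with x hx
    have hx : 0 < x := hx
    rw [Real.norm_of_nonneg (integral_nonneg fun _ => norm_nonneg _)]
    have h1 : ∫ τ in Ioi (0 : ℝ), ‖τ ^ (θ - 1) • (approx G x * approx G (x * τ))‖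
        ≤ ∫ τ in Ioi (0 : ℝ), D * D * min 1 (1 / x) * (τ ^ (θ - 1) * min 1 (1 / x / τ)) := by
      refine integral_mono_of_nonneg (Eventually.of_forall fun _ => norm_nonneg _)
        ((integrableOn_kernel hθ hθ1 (by positivity : 0 < 1 / x)).const_mul _) ?_
      filter_upwards [ae_restrict_mem measurableSet_Ioi] with τ hτ
      exact hbound x τ hx hτ
    refine h1.trans_eq ?_
    rw [integral_const_mul, integral_kernel hθ hθ1 (by positivity)]
    have h2 : (1 / x) ^ θ = x ^ (1 - θ - 1) := by
      rw [one_div, Real.inv_rpow hx.le, ← Real.rpow_neg hx.le]; congr 1; ring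
    rw [h2]; ring

/-- The product of the integrals for `G ^ (1 - θ)` and `G ^ θ` is a positive multiple of `G`. After
the substitution `(x, y) = (x, x τ)` the inner integral is of Frullani type. -/
lemma exists_powIntegral_mul_powIntegral [CompleteSpace X] (h : PositiveTypeWith G κ) {θ : ℝ}
    (hθ : 0 < θ) (hθ1 : θ < 1) :
    ∃ c : ℝ, 0 < c ∧ powIntegral G (1 - θ) * powIntegral G θ = c • G := by
  rcases eq_or_ne G 0 with rfl | hG
  · exact ⟨1, one_pos, by simp [powIntegral, approx]⟩
  have hint := h.integrable_prod_approx hθ hθ1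
  have hinner : ∀ x : ℝ, 0 < x → (x ^ (1 - θ - 1) • approx G x) * powIntegral G θ =
      ∫ τ in Ioi (0 : ℝ), τ ^ (θ - 1) • (approx G x * approx G (x * τ)) := by
    intro x hx
    have h1 := integral_comp_mul_left_Ioi (fun y : ℝ => y ^ (θ - 1) • approx G y) 0 hx
    rw [mul_zero] at h1
    have h2 : powIntegral G θ =
        x • ∫ τ in Ioi (0 : ℝ), (x * τ) ^ (θ - 1) • approx G (x * τ) := by
      rw [h1, smul_smul, mul_inv_cancel₀ hx.ne', one_smul, powIntegral]
    have h3 : IntegrableOn (fun τ : ℝ => (x * τ) ^ (θ - 1) • approx G (x * τ)) (Ioi 0) := by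
      have := (integrableOn_Ioi_comp_mul_left_iff (fun y : ℝ => y ^ (θ - 1) • approx G y) 0 hx)
      rw [mul_zero] at this
      exact this.2 (h.integrableOn_approx hθ hθ1)
    rw [h2, mul_smul_comm, ← integral_const_mul_of_integrable h3, ← integral_smul]
    refine setIntegral_congr_fun measurableSet_Ioi fun τ hτ => ?_
    have hτ : 0 < τ := hτ
    simp only [smul_mul_smul_comm, smul_smul]
    congr 1
    rw [Real.mul_rpow hx.le hτ.le]
    have : x * (x ^ (1 - θ - 1) * x ^ (θ - 1)) = 1 := by
      rw [← Real.rpow_add hx, show 1 - θ - 1 + (θ - 1) = -1 by ring, Real.rpow_neg_one,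
        mul_inv_cancel₀ hx.ne']
    linear_combination τ ^ (θ - 1) * this
  have hfrul : ∀ᵐ τ ∂(volume.restrict (Ioi (0 : ℝ))),
      ∫ x in Ioi (0 : ℝ), τ ^ (θ - 1) • (approx G x * approx G (x * τ)) =
        (τ ^ (θ - 1) * (Real.log τ / (τ - 1))) • G := by
    have hne : ∀ᵐ τ ∂(volume.restrict (Ioi (0 : ℝ))), τ ≠ 1 :=
      ae_restrict_of_ae (Measure.ae_ne volume 1)
    filter_upwards [hint.prod_left_ae, hne, ae_restrict_mem measurableSet_Ioi] with τ h1 h2 h3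
    have hτ : 0 < τ := h3
    have hp : τ ^ (θ - 1) ≠ 0 := by positivity
    rw [integral_smul, h.integral_approx_mul_approx hτ h2, smul_smul]
    exact (integrable_smul_iff hp _).1 h1
  -- As `G ≠ 0`, integrability of the scalar factor is inherited from the operator-valued integral.
  have hint2 : IntegrableOn (fun τ : ℝ => τ ^ (θ - 1) * (Real.log τ / (τ - 1))) (Ioi 0) := by
    rw [IntegrableOn, ← integrable_smul_const hG]
    exact hint.integral_prod_right.congr hfrul
  refine ⟨∫ τ in Ioi (0 : ℝ), τ ^ (θ - 1) * (Real.log τ / (τ - 1)), ?_, ?_⟩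
  · have hposi : ∀ τ : ℝ, 0 < τ → τ ≠ 1 → 0 < τ ^ (θ - 1) * (Real.log τ / (τ - 1)) := by
      intro τ hτ hτ1
      refine mul_pos (by positivity) ?_
      rcases lt_or_gt_of_ne hτ1 with h1 | h1
      · exact div_pos_of_neg_of_neg (Real.log_neg hτ h1) (by linarith)
      · exact div_pos (Real.log_pos h1) (by linarith)
    rw [setIntegral_pos_iff_support_of_nonneg_ae _ hint2]
    · refine lt_of_lt_of_le ?_ (measure_mono (s := Ioo 0 1) ?_)
      · simp
      · exact fun τ hτ => ⟨(hposi τ hτ.1 hτ.2.ne).ne', hτ.1⟩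
    · filter_upwards [ae_restrict_mem measurableSet_Ioi] with τ hτ
      rcases eq_or_ne τ 1 with rfl | h1
      · simp
      · exact (hposi τ hτ h1).le
  · rw [h.powIntegral_mul (by linarith) (by linarith),
      setIntegral_congr_fun measurableSet_Ioi fun x hx => hinner x hx,
      integral_integral_swap hint, integral_congr_ae hfrul, integral_smul_const]

end PositiveTypeWith
end Product

/-! ### Fractional powers and the residual operators -/

section Powers

variable {X : Type*} [NormedAddCommGroup X] [NormedSpace ℝ X]

lemma norm_pow_le_pow {T : X →L[ℝ] X} {D : ℝ} (hT : ‖T‖ ≤ D) (k : ℕ) : ‖T ^ k‖ ≤ D ^ k := by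
  rcases Nat.eq_zero_or_pos k with rfl | hk
  · rw [pow_zero, pow_zero]
    exact ContinuousLinearMap.norm_id_le
  · exact (norm_pow_le' _ hk).trans (pow_le_pow_left₀ (norm_nonneg _) hT k)

lemma norm_geom_sum_le {T : X →L[ℝ] X} {D : ℝ} (hT : ‖T‖ ≤ D) (k : ℕ) :
    ‖∑ j ∈ Finset.range k, T ^ j‖ ≤ ∑ j ∈ Finset.range k, D ^ j :=
  norm_sum_le_of_le _ fun j _ => norm_pow_le_pow hT j

namespace PositiveTypeWith

variable {G : X →L[ℝ] X} {κ : ℝ}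

/-- For `0 ≤ θ < 1` the power `T = G ^ θ` is a bounded operator with a complementary factor `H`
such that `H T = G`; both behave on residuals like powers of the parameter. -/
lemma exists_complementary_factors [CompleteSpace X] (h : PositiveTypeWith G κ) {θ : ℝ}
    (hθ : 0 ≤ θ) (hθ1 : θ < 1) :
    ∃ (T H : X →L[ℝ] X) (C : ℝ), 0 ≤ C ∧
      (∀ u, (if θ = 0 then u else balakrishnan G θ u) = T u) ∧
      Commute T G ∧ Commute H G ∧ H * T = G ∧
      (∀ β : ℝ, 0 < β → ‖T * residual G β‖ ≤ C * β ^ θ) ∧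
      (∀ β : ℝ, 0 < β → ‖H * residual G β‖ ≤ C * β ^ (1 - θ)) := by
  have hκ := h.pos
  rcases hθ.eq_or_lt with rfl | hθ
  · refine ⟨1, G, 1 + κ, by positivity, by simp, Commute.one_left G, Commute.refl G, mul_one G,
      fun β hβ => ?_, fun β hβ => ?_⟩
    · simpa using (h.norm_residual_le hβ).trans (by linarith)
    · simpa using h.norm_mul_residual_le hβ
  · obtain ⟨c, hc, hcG⟩ := h.exists_powIntegral_mul_powIntegral hθ hθ1
    set S : ℝ := Real.sin (Real.pi * θ) / Real.pi with hS
    have hS0 : 0 < S := by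
      refine div_pos (Real.sin_pos_of_pos_of_lt_pi (by positivity) ?_) Real.pi_pos
      nlinarith [Real.pi_pos]
    have hθ1' : 0 < 1 - θ := by linarith
    set D : ℝ := (1 + κ) * κ * (1 / θ + 1 / (1 - θ)) with hD
    have hD0 : 0 ≤ D := by positivity
    have hG : ∀ q : ℝ, 0 < q → q < 1 → Commute (powIntegral G q) G := fun q hq hq1 =>
      (h.commute_powIntegral hq hq1 (Commute.refl G)).symm
    refine ⟨S • powIntegral G θ, (S * c)⁻¹ • powIntegral G (1 - θ), (S + (S * c)⁻¹) * D,
      by positivity, fun u => ?_, (hG θ hθ hθ1).smul_left _,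
      (hG (1 - θ) hθ1' (by linarith)).smul_left _, ?_, fun β hβ => ?_, fun β hβ => ?_⟩
    · rw [if_neg hθ.ne', h.balakrishnan_eq hθ hθ1]
      rfl
    · rw [smul_mul_smul_comm, hcG, smul_smul]
      have : (S * c)⁻¹ * S * c = 1 := by field_simp
      rw [this, one_smul]
    · rw [smul_mul_assoc, norm_smul, Real.norm_of_nonneg hS0.le]
      have h1 := h.norm_powIntegral_mul_residual_le hθ hθ1 hβ
      have h2 : 0 ≤ (S * c)⁻¹ * D * β ^ θ := by positivity
      calc S * ‖powIntegral G θ * residual G β‖ ≤ S * (D * β ^ θ) := by gcongr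
        _ ≤ _ := by linarith
    · rw [smul_mul_assoc, norm_smul, Real.norm_of_nonneg (by positivity)]
      have h1 := h.norm_powIntegral_mul_residual_le hθ1' (by linarith) hβ
      have h2 : 0 ≤ S * D * β ^ (1 - θ) := by positivity
      have h3 : (1 + κ) * κ * (1 / (1 - θ) + 1 / (1 - (1 - θ))) = D := by
        rw [hD, sub_sub_cancel]; ring
      rw [h3] at h1
      calc (S * c)⁻¹ * ‖powIntegral G (1 - θ) * residual G β‖
          ≤ (S * c)⁻¹ * (D * β ^ (1 - θ)) := by gcongr
        _ ≤ _ := by linarith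

/-- The power `G ^ a`, `a > 0`, is a bounded operator `P`. A power of the residual operator gains
the factor `β ^ a` under `P`, and the same power of `I - residual` can be estimated through `P` at
the price of the factor `β ^ (-a)`. -/
lemma exists_fracPow_operator [CompleteSpace X] (h : PositiveTypeWith G κ) {a : ℝ} (ha : 0 < a) :
    ∃ (P : X →L[ℝ] X) (m : ℕ) (C : ℝ), 0 ≤ C ∧ (∀ u, fracPow G a u = P u) ∧
      (∀ β : ℝ, 0 < β → ‖P * residual G β ^ m‖ ≤ C * β ^ a) ∧
      (∀ β : ℝ, 0 < β → ∀ v : X, ‖(approx G β ^ m) v‖ ≤ C * β ^ (-a) * ‖P v‖) := by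
  have hκ := h.pos
  obtain ⟨T, H, C, hC, hT, hTG, hHG, hHT, hTR, hHR⟩ :=
    h.exists_complementary_factors (Int.fract_nonneg a) (Int.fract_lt_one a)
  set k : ℕ := ⌊a⌋₊ with hk
  set θ : ℝ := Int.fract a with hθ
  have hkθ : a = k + θ := by
    rw [hk, hθ, natCast_floor_eq_intCast_floor ha.le, Int.floor_add_fract]
  refine ⟨T * G ^ k, k + 1, C * (1 + κ) ^ k, by positivity, fun u => ?_, fun β hβ => ?_,
    fun β hβ v => ?_⟩
  · rw [fracPow, if_pos ha.le, nonnegPow]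
    exact hT ((G ^ k) u)
  · have hc : Commute G (residual G β) := (residual_commute β).symm
    have h1 : T * G ^ k * residual G β ^ (k + 1) = T * residual G β * (G * residual G β) ^ k := by
      rw [hc.mul_pow, pow_succ', mul_assoc, ← mul_assoc (G ^ k), (hc.pow_left k).eq]
      simp only [mul_assoc]
    have h2 : β ^ a = β ^ θ * β ^ k := by
      rw [hkθ, Real.rpow_add hβ, Real.rpow_natCast]; ring
    have h3 : ‖(G * residual G β) ^ k‖ ≤ ((1 + κ) * β) ^ k :=
      norm_pow_le_pow (h.norm_mul_residual_le hβ) k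
    rw [h1, h2]
    calc ‖T * residual G β * (G * residual G β) ^ k‖
        ≤ (C * β ^ θ) * ((1 + κ) * β) ^ k :=
          (norm_mul_le _ _).trans (mul_le_mul (hTR β hβ) h3 (norm_nonneg _) (by positivity))
      _ = _ := by rw [mul_pow]; ring
  · have hc : Commute G (residual G β) := (residual_commute β).symm
    have hHc : H * residual G β = residual G β * H := commute_residual hHG β
    have h0 : β • approx G β = G * residual G β := by
      rw [residual, mul_smul_comm, approx]
    have h1 : β ^ (k + 1) • approx G β ^ (k + 1) =
        residual G β ^ k * (H * residual G β) * (T * G ^ k) := by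
      rw [← smul_pow, h0, hc.mul_pow, ((hc.pow_left (k + 1)).pow_right (k + 1)).eq, hHc,
        pow_succ, pow_succ' G k]
      simp only [mul_assoc]
      rw [← mul_assoc H T, hHT]
    have h2 : (approx G β ^ (k + 1)) v =
        (β ^ (k + 1))⁻¹ • (residual G β ^ k * (H * residual G β)) ((T * G ^ k) v) := by
      rw [← mul_apply_eq_comp, ← h1, _root_.smul_apply, smul_smul,
        inv_mul_cancel₀ (by positivity), one_smul]
    have h3 : ‖residual G β ^ k‖ ≤ (1 + κ) ^ k :=
      norm_pow_le_pow ((h.norm_residual_le hβ).trans (by linarith)) k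
    have h4 : ‖residual G β ^ k * (H * residual G β)‖ ≤ (1 + κ) ^ k * (C * β ^ (1 - θ)) :=
      (norm_mul_le _ _).trans (mul_le_mul h3 (hHR β hβ) (norm_nonneg _) (by positivity))
    have h5 : β ^ (-a) = (β ^ (k + 1))⁻¹ * β ^ (1 - θ) := by
      rw [← Real.rpow_natCast, ← Real.rpow_neg hβ.le, ← Real.rpow_add hβ, hkθ]
      congr 1; push_cast; ring
    rw [h2, norm_smul, Real.norm_of_nonneg (by positivity), h5]
    calc (β ^ (k + 1))⁻¹ * ‖(residual G β ^ k * (H * residual G β)) ((T * G ^ k) v)‖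
        ≤ (β ^ (k + 1))⁻¹ * ((1 + κ) ^ k * (C * β ^ (1 - θ)) * ‖(T * G ^ k) v‖) := by
          gcongr
          exact ContinuousLinearMap.le_of_opNorm_le _ h4 _
      _ = _ := by ring

end PositiveTypeWith

/-! ### Decay of the residuals under smoothness assumptions -/

namespace PositiveTypeWith

variable {G : X →L[ℝ] X} {κ : ℝ}

lemma norm_residual_apply_range_le (h : PositiveTypeWith G κ) {β : ℝ} (hβ : 0 < β) (z : X) :
    ‖residual G β (G z)‖ ≤ (1 + κ) * β * ‖z‖ := by
  have h1 : residual G β (G z) = (G * residual G β) z := by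
    rw [← (residual_commute β).eq]; rfl
  rw [h1]
  exact ContinuousLinearMap.le_of_opNorm_le _ (h.norm_mul_residual_le hβ) _

lemma tendsto_residual_of_mem_closure (h : PositiveTypeWith G κ) {u : X}
    (hu : u ∈ closure (range G)) :
    Tendsto (fun β => ‖residual G β u‖) (𝓝[>] 0) (𝓝 0) := by
  have hκ := h.pos
  rw [Metric.tendsto_nhds]
  intro ε hε
  obtain ⟨_, ⟨z, rfl⟩, hz⟩ := Metric.mem_closure_iff.1 hu (ε / (2 * κ)) (by positivity)
  have h1 : Tendsto (fun β : ℝ => (1 + κ) * β * ‖z‖) (𝓝[>] 0) (𝓝 0) := by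
    have : Tendsto (fun β : ℝ => (1 + κ) * β * ‖z‖) (𝓝 0) (𝓝 ((1 + κ) * 0 * ‖z‖)) :=
      (tendsto_id.const_mul _).mul_const _
    simpa using this.mono_left nhdsWithin_le_nhds
  filter_upwards [h1.eventually (gt_mem_nhds (half_pos hε)), self_mem_nhdsWithin] with β h2 hβ
  have hβ : 0 < β := hβ
  rw [dist_zero_right, norm_norm]
  have h3 : residual G β u = residual G β (u - G z) + residual G β (G z) := by
    rw [← map_add, sub_add_cancel]
  have h4 : ‖residual G β (u - G z)‖ ≤ κ * ‖u - G z‖ :=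
    ContinuousLinearMap.le_of_opNorm_le _ (h.norm_residual_le hβ) _
  rw [dist_eq_norm] at hz
  have h5 : κ * ‖u - G z‖ < ε / 2 := by
    calc κ * ‖u - G z‖ < κ * (ε / (2 * κ)) := by gcongr
      _ = ε / 2 := by field_simp
  rw [h3]
  linarith [norm_add_le (residual G β (u - G z)) (residual G β (G z)),
    h.norm_residual_apply_range_le hβ z]

lemma exists_norm_residual_le_of_mem_scaleSpace [CompleteSpace X] (h : PositiveTypeWith G κ) {p : ℝ}
    (hp : 0 < p) (hp1 : p ≤ 1) {u : X} (hu : u ∈ scaleSpace G p) :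
    ∃ C : ℝ, 0 ≤ C ∧ ∀ β : ℝ, 0 < β → ‖residual G β u‖ ≤ C * β ^ p := by
  have hκ := h.pos
  rw [scaleSpace, if_pos hp] at hu
  obtain ⟨z, rfl⟩ := hu
  rcases hp1.eq_or_lt with rfl | hp1
  · refine ⟨(1 + κ) * ‖z‖, by positivity, fun β hβ => ?_⟩
    have h1 : fracPow G 1 z = G z := by simp [fracPow, nonnegPow]
    rw [h1, Real.rpow_one]
    exact (h.norm_residual_apply_range_le hβ z).trans_eq (by ring)
  · have hfl : ⌊p⌋₊ = 0 := Nat.floor_eq_zero.2 hp1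
    have hfr : Int.fract p = p := Int.fract_eq_self.2 ⟨hp.le, hp1⟩
    obtain ⟨T, H, C, hC, hT, hTG, hHG, hHT, hTR, hHR⟩ := h.exists_complementary_factors hp.le hp1
    refine ⟨C * ‖z‖, by positivity, fun β hβ => ?_⟩
    have h1 : fracPow G p z = T z := by
      rw [fracPow, if_pos hp.le, nonnegPow, hfl, hfr]
      exact hT z
    have h2 : residual G β (T z) = (T * residual G β) z := by
      rw [(commute_residual hTG β).eq]; rfl
    rw [h1, h2]
    exact (ContinuousLinearMap.le_of_opNorm_le _ (hTR β hβ) z).trans_eq (by ring)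

/-- The residual of `G ^ p u`, with the part of the Balakrishnan integral over `s ≤ β` estimated
through the residual of `u` itself. -/
lemma norm_residual_fracPow_le [CompleteSpace X] (h : PositiveTypeWith G κ) {p β : ℝ} (hp : 0 < p) (hp1 : p < 1)
    (hβ : 0 < β) (u : X) :
    ‖residual G β (fracPow G p u)‖ ≤
      ((1 + κ) * ‖residual G β u‖ + (1 + κ) * κ * ‖u‖ * (p / (1 - p))) * β ^ p := by
  have hκ := h.pos
  have hfl : ⌊p⌋₊ = 0 := Nat.floor_eq_zero.2 hp1
  have hfr : Int.fract p = p := Int.fract_eq_self.2 ⟨hp.le, hp1⟩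
  have hp1' : 0 < 1 - p := by linarith
  set S : ℝ := Real.sin (Real.pi * p) / Real.pi with hS
  have hpp : Real.pi * p < Real.pi := by nlinarith [Real.pi_pos]
  have hS0 : 0 ≤ S :=
    div_nonneg (Real.sin_nonneg_of_nonneg_of_le_pi (by positivity) hpp.le) Real.pi_pos.le
  have hSp : S ≤ p := by
    rw [hS, div_le_iff₀ Real.pi_pos, mul_comm p]
    exact Real.sin_le (by positivity)
  have h1 : residual G β (fracPow G p u) = S • (powIntegral G p * residual G β) u := by
    rw [fracPow, if_pos hp.le, nonnegPow, hfl, hfr, if_neg hp.ne', h.balakrishnan_eq hp hp1,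
      map_smul, ← (h.commute_powIntegral hp hp1 (residual_commute β)).eq]
    rfl
  set ψ := ‖residual G β u‖ with hψ
  have hint : IntegrableOn (fun s : ℝ => (s ^ (p - 1) • approx G s) (residual G β u)) (Ioi 0) :=
    (h.integrableOn_approx hp hp1).apply_continuousLinearMap _
  have h2 : (powIntegral G p * residual G β) u =
      (∫ s in Ioc 0 β, (s ^ (p - 1) • approx G s) (residual G β u)) +
        ∫ s in Ioi β, (s ^ (p - 1) • approx G s) (residual G β u) := by
    rw [← setIntegral_union (Ioc_disjoint_Ioi le_rfl) measurableSet_Ioi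
      (hint.mono_set Ioc_subset_Ioi_self) (hint.mono_set (Ioi_subset_Ioi hβ.le)),
      Ioc_union_Ioi_eq_Ioi hβ.le, mul_apply_eq_comp, powIntegral,
      ContinuousLinearMap.integral_apply (h.integrableOn_approx hp hp1)]
  have h3 : ‖∫ s in Ioc 0 β, (s ^ (p - 1) • approx G s) (residual G β u)‖
      ≤ (1 + κ) * ψ * (β ^ p / p) := by
    rw [← (integrableOn_kernel_Ioc hp hβ).2, ← integral_const_mul]
    refine norm_integral_le_of_norm_le ((integrableOn_kernel_Ioc hp hβ).1.const_mul _) ?_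
    filter_upwards [ae_restrict_mem measurableSet_Ioc] with s hs
    have hs0 : 0 < s := hs.1
    rw [min_eq_left ((one_le_div hs0).2 hs.2), _root_.smul_apply, norm_smul,
      Real.norm_of_nonneg (by positivity), mul_one, mul_comm]
    gcongr
    exact ContinuousLinearMap.le_of_opNorm_le _ (h.norm_approx_le hs0) _
  have h4 : ‖∫ s in Ioi β, (s ^ (p - 1) • approx G s) (residual G β u)‖
      ≤ (1 + κ) * κ * ‖u‖ * (β ^ p / (1 - p)) := by
    rw [← (integrableOn_kernel_Ioi hp1 hβ).2, ← integral_const_mul]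
    refine norm_integral_le_of_norm_le ((integrableOn_kernel_Ioi hp1 hβ).1.const_mul _) ?_
    filter_upwards [ae_restrict_mem measurableSet_Ioi] with s hs
    have hs0 : 0 < s := hβ.trans hs
    rw [_root_.smul_apply, norm_smul, Real.norm_of_nonneg (by positivity)]
    have := ContinuousLinearMap.le_of_opNorm_le _ (h.norm_approx_mul_residual_le hs0 hβ) u
    calc s ^ (p - 1) * ‖approx G s (residual G β u)‖
        ≤ s ^ (p - 1) * ((1 + κ) * κ * min 1 (β / s) * ‖u‖) := by gcongr; exact this
      _ = _ := by ring
  rw [h1, h2, norm_smul, Real.norm_of_nonneg hS0]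
  calc S * ‖_‖ ≤ p * ((1 + κ) * ψ * (β ^ p / p) + (1 + κ) * κ * ‖u‖ * (β ^ p / (1 - p))) := by
        gcongr
        exact (norm_add_le _ _).trans (add_le_add h3 h4)
    _ = _ := by field_simp

/-- On the domain of `log G` the residual decays logarithmically: take
`p = N / log (1 / β)`, so that `β ^ p = exp (-N)`, with `N` large enough to absorb the residual of
`u` on the right-hand side of `norm_residual_fracPow_le`. -/
lemma exists_norm_residual_le_of_mem_logDomain [CompleteSpace X] (h : PositiveTypeWith G κ) {u : X}
    (hu : u ∈ logDomain G) :
    ∃ C : ℝ, 0 ≤ C ∧ ∀ᶠ β in 𝓝[>] (0 : ℝ), ‖residual G β u‖ ≤ C / Real.log (1 / β) := by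
  have hκ := h.pos
  obtain ⟨l, hl⟩ := hu
  set N : ℝ := Real.log (2 * (1 + κ)) with hN
  have hN0 : 0 < N := Real.log_pos (by linarith)
  have hexp : Real.exp (-N) = (2 * (1 + κ))⁻¹ := by
    rw [Real.exp_neg, hN, Real.exp_log (by positivity)]
  have hlog : Tendsto (fun β : ℝ => Real.log (1 / β)) (𝓝[>] 0) atTop := by
    simp only [one_div]
    exact Real.tendsto_log_atTop.comp tendsto_inv_nhdsGT_zero
  have hp : Tendsto (fun β : ℝ => N / Real.log (1 / β)) (𝓝[>] 0) (𝓝[>] 0) := by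
    refine tendsto_nhdsWithin_iff.2 ⟨hlog.const_div_atTop N, ?_⟩
    filter_upwards [hlog.eventually_gt_atTop 0] with β hβ
    exact div_pos hN0 hβ
  have hK := hl.norm.eventually (gt_mem_nhds (lt_add_one ‖l‖))
  have hhalf : ∀ᶠ p : ℝ in 𝓝[>] 0, p < 1 / 2 :=
    mem_nhdsWithin_of_mem_nhds (gt_mem_nhds (by norm_num))
  refine ⟨2 * N * (κ * ‖u‖ + κ * (‖l‖ + 1)), by positivity, ?_⟩
  filter_upwards [hp.eventually hK, hp.eventually hhalf, hlog.eventually_gt_atTop 0,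
    self_mem_nhdsWithin] with β h1 h2 h3 hβ
  have hβ : 0 < β := hβ
  set p : ℝ := N / Real.log (1 / β) with hpdef
  have hp0 : 0 < p := div_pos hN0 h3
  have hβp : β ^ p = (2 * (1 + κ))⁻¹ := by
    rw [Real.rpow_def_of_pos hβ, ← hexp, hpdef, one_div, Real.log_inv]
    rw [one_div, Real.log_inv] at h3
    have : Real.log β ≠ 0 := by linarith
    congr 1
    field_simp
  have h4 := h.norm_residual_fracPow_le hp0 (by linarith) hβ u
  rw [hβp] at h4
  have h5 : ‖fracPow G p u - u‖ ≤ (‖l‖ + 1) * p := by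
    rw [norm_smul, norm_inv, Real.norm_of_nonneg hp0.le, inv_mul_lt_iff₀ hp0] at h1
    linarith
  have h6 : ‖residual G β (fracPow G p u - u)‖ ≤ κ * ((‖l‖ + 1) * p) :=
    (ContinuousLinearMap.le_of_opNorm_le _ (h.norm_residual_le hβ) _).trans (by gcongr)
  have h7 : residual G β u = residual G β (fracPow G p u) - residual G β (fracPow G p u - u) := by
    rw [map_sub, sub_sub_cancel]
  have h8 : ‖residual G β u‖ ≤ ‖residual G β (fracPow G p u)‖ +
      ‖residual G β (fracPow G p u - u)‖ := by
    conv_lhs => rw [h7]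
    exact norm_sub_le _ _
  have h9 : p / (1 - p) ≤ 2 * p := by
    rw [div_le_iff₀ (by linarith)]; nlinarith
  have h10 : ((1 + κ) * ‖residual G β u‖ + (1 + κ) * κ * ‖u‖ * (p / (1 - p))) *
      (2 * (1 + κ))⁻¹ ≤ ‖residual G β u‖ / 2 + κ * ‖u‖ * p := by
    calc _ = ‖residual G β u‖ / 2 + κ * ‖u‖ * (p / (1 - p)) / 2 := by field_simp
      _ ≤ ‖residual G β u‖ / 2 + κ * ‖u‖ * (2 * p) / 2 := by gcongr
      _ = _ := by ring
  have h11 : ‖residual G β u‖ ≤ 2 * (κ * ‖u‖ + κ * (‖l‖ + 1)) * p := by nlinarith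
  calc ‖residual G β u‖ ≤ 2 * (κ * ‖u‖ + κ * (‖l‖ + 1)) * p := h11
    _ = _ := by rw [hpdef]; ring

end PositiveTypeWith
end Powers

/-! ### Interpolation and the auxiliary elements -/

section Interpolation

variable {X : Type*} [NormedAddCommGroup X] [NormedSpace ℝ X]

lemma fracPow_one (G : X →L[ℝ] X) : fracPow G 1 = G := by
  funext u
  simp [fracPow, nonnegPow]

lemma mem_scaleSpace_one {G : X →L[ℝ] X} {u : X} : u ∈ scaleSpace G 1 ↔ ∃ z, G z = u := by
  rw [scaleSpace, if_pos one_pos, fracPow_one]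
  rfl

lemma scaleNorm_one {G : X →L[ℝ] X} (hG : Function.Injective G) (z : X) :
    scaleNorm G 1 (G z) = ‖z‖ := by
  have h1 : nonnegPow G (-(-1)) = G := by
    funext u
    simp [nonnegPow]
  rw [scaleNorm, fracPow, if_neg (by norm_num), h1, Function.leftInverse_invFun hG]

namespace PositiveTypeWith

variable {G : X →L[ℝ] X} {κ : ℝ}

/-- The interpolation inequality between `X₁`, `X` and `X₋ₐ`, in additive form with a free
parameter: split `G z` by a power `m` of `approx G β = I - residual G β`. -/
lemma norm_apply_le_interpolation (h : PositiveTypeWith G κ) {a C : ℝ} {m : ℕ} {P : X →L[ℝ] X}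
    (hP : ∀ β : ℝ, 0 < β → ∀ v : X, ‖(approx G β ^ m) v‖ ≤ C * β ^ (-a) * ‖P v‖)
    {β : ℝ} (hβ : 0 < β) (z : X) :
    ‖G z‖ ≤ (∑ j ∈ Finset.range m, (1 + κ) ^ j) * (1 + κ) * (β * ‖z‖) +
      C * (β ^ (-a) * ‖P (G z)‖) := by
  have h1 : (∑ j ∈ Finset.range m, approx G β ^ j) * residual G β = 1 - approx G β ^ m := by
    rw [← geom_sum_mul_neg, h.approx_eq hβ, sub_sub_cancel]
  have h2 : G z = (∑ j ∈ Finset.range m, approx G β ^ j) (residual G β (G z)) +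
      (approx G β ^ m) (G z) := by
    rw [← mul_apply_eq_comp, h1, _root_.sub_apply, one_apply_eq_self, sub_add_cancel]
  have h3 := ContinuousLinearMap.le_of_opNorm_le_of_le _
    (norm_geom_sum_le (h.norm_approx_le hβ) m) (h.norm_residual_apply_range_le hβ z)
  have h4 := norm_add_le ((∑ j ∈ Finset.range m, approx G β ^ j) (residual G β (G z)))
    ((approx G β ^ m) (G z))
  rw [← h2] at h4
  linarith [hP β hβ (G z)]

/-- The element `w - residual ^ n w` is `G z` with `z` of size `β⁻¹ ‖residual w‖`. -/
lemma exists_apply_eq_sub_residual_pow (h : PositiveTypeWith G κ) {β : ℝ} (hβ : 0 < β) (n : ℕ)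
    (w : X) :
    ∃ z, G z = w - (residual G β ^ n) w ∧
      β * ‖z‖ ≤ (∑ j ∈ Finset.range n, (1 + κ) ^ j) * ‖residual G β w‖ := by
  have hres : ‖residual G β‖ ≤ 1 + κ := (h.norm_residual_le hβ).trans (by linarith)
  refine ⟨(∑ j ∈ Finset.range n, residual G β ^ j) (res G β w), ?_, ?_⟩
  · have hc : Commute G (∑ j ∈ Finset.range n, residual G β ^ j) :=
      Commute.sum_right _ _ _ fun j _ => (residual_commute β).symm.pow_right j
    have h1 : G * ((∑ j ∈ Finset.range n, residual G β ^ j) * res G β) =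
        1 - residual G β ^ n := by
      rw [← mul_assoc, hc.eq, mul_assoc, ← geom_sum_mul_neg]
      congr 1
      exact h.approx_eq hβ
    exact congrArg (fun T : X →L[ℝ] X => T w) h1
  · have h1 : β * ‖(∑ j ∈ Finset.range n, residual G β ^ j) (res G β w)‖ =
        ‖(∑ j ∈ Finset.range n, residual G β ^ j) (residual G β w)‖ := by
      rw [show residual G β w = β • res G β w from rfl, map_smul, norm_smul,
        Real.norm_of_nonneg hβ.le]
    rw [h1]
    exact ContinuousLinearMap.le_of_opNorm_le _ (norm_geom_sum_le hres n) _

end PositiveTypeWith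
end Interpolation

/-! ### The error estimate for regularized solutions -/

section ErrorEstimate

lemma tikhonov_apply {X Y : Type*} [NormedAddCommGroup X] [NormedSpace ℝ X]
    [NormedAddCommGroup Y] {G : X →L[ℝ] X} (hG : Function.Injective G) (F : X → Y) (z₀ : X)
    (r : ℝ) {α : ℝ} (hα : 0 ≤ α) (f : Y) (z : X) :
    tikhonov G F (G z₀) r α f (G z) =
      ENNReal.ofReal (‖F (G z) - f‖ ^ r + α * ‖z - z₀‖ ^ r) := by
  rw [tikhonov, penalty, if_pos (mem_scaleSpace_one.2 ⟨z, rfl⟩), ← map_sub, scaleNorm_one hG,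
    ← ENNReal.ofReal_mul hα, ← ENNReal.ofReal_add (by positivity) (by positivity)]

lemma IsRegularizedSolution.exists_apply_eq {X Y : Type*} [NormedAddCommGroup X]
    [NormedSpace ℝ X] [NormedAddCommGroup Y] {G : X →L[ℝ] X} (hG : Function.Injective G)
    {F : X → Y} {DF : Set X} {z₀ u : X} {r α : ℝ} {f : Y} (hα : 0 < α)
    (hu : IsRegularizedSolution G F DF (G z₀) r α f u) {z₁ : X} (hz₁ : G z₁ ∈ DF) :
    ∃ z, G z = u ∧ ‖F u - f‖ ^ r + α * ‖z - z₀‖ ^ r ≤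
      ‖F (G z₁) - f‖ ^ r + α * ‖z₁ - z₀‖ ^ r := by
  have h1 := hu.2 _ hz₁
  rw [tikhonov_apply hG F z₀ r hα.le] at h1
  have hmem : u ∈ scaleSpace G 1 := by
    by_contra hn
    rw [tikhonov, penalty, if_neg hn,
      ENNReal.mul_top (by simpa using hα), add_top, top_le_iff] at h1
    exact ENNReal.ofReal_ne_top h1
  obtain ⟨z, rfl⟩ := mem_scaleSpace_one.1 hmem
  rw [tikhonov_apply hG F z₀ r hα.le,
    ENNReal.ofReal_le_ofReal_iff (by positivity)] at h1
  exact ⟨z, rfl, h1⟩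

lemma le_mul_of_rpow_le {r x E : ℝ} (hr : 0 < r) (hx : 0 ≤ x) (hE : 0 ≤ E)
    (h : x ^ r ≤ 2 * E ^ r) : x ≤ 2 ^ (1 / r) * E := by
  have h1 : ((2 : ℝ) ^ (1 / r) * E) ^ r = 2 * E ^ r := by
    rw [Real.mul_rpow (by positivity) hE, ← Real.rpow_mul (by norm_num), one_div,
      inv_mul_cancel₀ hr.ne', Real.rpow_one]
  rw [← h1] at h
  exact (Real.rpow_le_rpow_iff hx (by positivity) hr).1 h

/-- The error of a regularized solution for the parameter `α = β ^ (r (a + 1))` is controlled by the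
residual of `ust - ubar` at `β` and by the propagated data noise `δ β ^ (-a)`. -/
theorem MainAssumption.exists_error_le {X Y Z : Type*} [NormedAddCommGroup X] [NormedSpace ℝ X]
    [CompleteSpace X] [NormedAddCommGroup Y] [NormedSpace ℝ Y] [NormedAddCommGroup Z]
    [NormedSpace ℝ Z] {e : X ≃ₗᵢ[ℝ] StrongDual ℝ Z} {G : X →L[ℝ] X} {F : X → Y}
    {DF : Set X} {ust : X} {fst : Y} {ubar : X} {a r κ : ℝ}
    (h : MainAssumption e G F DF ust fst ubar a) (hκ : PositiveTypeWith G κ) (hr : 0 < r)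
    (hψ : Tendsto (fun β => ‖residual G β (ust - ubar)‖) (𝓝[>] 0) (𝓝 0)) :
    ∃ C δ₀ : ℝ, 0 ≤ C ∧ 0 < δ₀ ∧ ∀ᶠ β in 𝓝[>] (0 : ℝ), ∀ δ : ℝ, 0 < δ → δ ≤ δ₀ →
      ∀ fδ : Y, ‖fδ - fst‖ ≤ δ →
        ∀ u : X, IsRegularizedSolution G F DF ubar r (β ^ (r * (a + 1))) fδ u →
          ‖u - ust‖ ≤ C * (‖residual G β (ust - ubar)‖ + δ * β ^ (-a)) := by
  have hinj := h.injective
  have ha := h.a_pos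
  have hκ0 := hκ.pos
  obtain ⟨z₀, rfl⟩ := mem_scaleSpace_one.1 h.guess_mem.1
  obtain ⟨ca, cb, c₀, c₁, hca, hcab, hc₀, hc₁, hup, hlow⟩ := h.nonlinearity
  obtain ⟨P, m, C, hC, hPeq, hPres, hPapp⟩ := hκ.exists_fracPow_operator ha
  have hcb : 0 < cb := hca.trans_le hcab
  have hweak : ∀ v, scaleNorm G (-a) v = ‖P v‖ := fun v => by rw [scaleNorm, neg_neg, hPeq]
  simp only [hweak] at hup hlow
  set w : X := ust - G z₀ with hw
  set ψ : ℝ → ℝ := fun β => ‖residual G β w‖ with hψdef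
  set S : ℝ := ∑ j ∈ Finset.range (m + 1), (1 + κ) ^ j with hS
  have hS0 : 0 ≤ S := Finset.sum_nonneg fun j _ => by positivity
  set S' : ℝ := ∑ j ∈ Finset.range m, (1 + κ) ^ j with hS'
  have hS'0 : 0 ≤ S' := Finset.sum_nonneg fun j _ => by positivity
  set K : ℝ := cb * C + S + C with hK
  have hK0 : 0 ≤ K := by positivity
  set L : ℝ := 2 ^ (1 / r) with hL
  have hL0 : 0 < L := by positivity
  have hβψ : Tendsto (fun β : ℝ => ψ β * β ^ a) (𝓝[>] 0) (𝓝 0) := by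
    have hβa := (Real.continuousAt_rpow_const 0 a (Or.inr ha.le)).tendsto
    rw [Real.zero_rpow ha.ne'] at hβa
    simpa using hψ.mul (hβa.mono_left nhdsWithin_le_nhds)
  obtain ⟨ε, hε, hball⟩ := Metric.mem_nhds_iff.1 (mem_interior_iff_mem_nhds.1 h.solution_interior)
  have hsmall : ∀ {g : ℝ → ℝ} (D : ℝ) {b : ℝ}, Tendsto g (𝓝[>] 0) (𝓝 0) → 0 < b →
      ∀ᶠ β in 𝓝[>] (0 : ℝ), D * g β < b := by
    intro g D b hg hb
    have := hg.const_mul D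
    rw [mul_zero] at this
    exact this.eventually (gt_mem_nhds hb)
  set B : ℝ := S' * (1 + κ) * (L + 1) + C * ((L + 1) / ca + 1) with hB
  have hB0 : 0 ≤ B := by positivity
  clear_value S S' L K B
  refine ⟨B * K + B + (1 + κ) ^ m, c₁ / (2 * (L + 1)), by positivity, by positivity, ?_⟩
  filter_upwards [hsmall ((1 + κ) ^ m) hψ hε, hsmall C hβψ hc₀,
    hsmall ((L + 1) * K) hβψ (half_pos hc₁), self_mem_nhdsWithin]
    with β h1 h2 h3 hβ δ hδ hδ0 fδ hfδ u hu
  have hβ : 0 < β := hβ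
  have hψ0 : 0 ≤ ψ β := norm_nonneg _
  have hψβ0 : 0 ≤ ψ β * β ^ a := by positivity
  set E : ℝ := K * (ψ β * β ^ a) + δ with hE
  have hE0 : 0 ≤ E := by positivity
  clear_value E
  -- The auxiliary element `G (z₀ + z₁) = ust - residual ^ (m + 1) w` is admissible, and close to
  -- `ust` both in the norm of `X` and in the weak norm.
  obtain ⟨z₁, hz₁, hz₁norm⟩ := hκ.exists_apply_eq_sub_residual_pow hβ (m + 1) w
  rw [← hS] at hz₁norm
  have haux : G (z₀ + z₁) - ust = -(residual G β ^ (m + 1)) w := by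
    rw [map_add, hz₁, hw]; abel
  have hres : ‖residual G β‖ ≤ 1 + κ := (hκ.norm_residual_le hβ).trans (by linarith)
  have hdist : ‖G (z₀ + z₁) - ust‖ ≤ (1 + κ) ^ m * ψ β := by
    rw [haux, norm_neg, pow_succ, mul_apply_eq_comp]
    exact ContinuousLinearMap.le_of_opNorm_le _ (norm_pow_le_pow hres m) _
  have hweakdist : ‖P (G (z₀ + z₁) - ust)‖ ≤ C * (ψ β * β ^ a) := by
    rw [haux, map_neg, norm_neg, pow_succ, mul_apply_eq_comp, ← mul_apply_eq_comp]
    exact (ContinuousLinearMap.le_of_opNorm_le _ (hPres β hβ) _).trans_eq (by ring)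
  have hmem : G (z₀ + z₁) ∈ DF := hball (by
    rw [Metric.mem_ball, dist_eq_norm]; exact hdist.trans_lt h1)
  have hFaux : ‖F (G (z₀ + z₁)) - fδ‖ ≤ E := by
    have h4 := hup _ ⟨hmem, mem_scaleSpace_one.2 ⟨_, rfl⟩⟩ (hweakdist.trans h2.le)
    have h5 : cb * ‖P (G (z₀ + z₁) - ust)‖ ≤ cb * (C * (ψ β * β ^ a)) := by gcongr
    have h6 := norm_sub_le_norm_sub_add_norm_sub (F (G (z₀ + z₁))) fst fδ
    rw [norm_sub_rev fst fδ] at h6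
    have h7 : 0 ≤ (S + C) * (ψ β * β ^ a) := by positivity
    rw [hE, hK]
    linarith
  -- Comparison of the minimizer with the auxiliary element.
  have hαpow : ∀ x : ℝ, 0 ≤ x → β ^ (r * (a + 1)) * x ^ r = (β ^ (a + 1) * x) ^ r := by
    intro x hx
    rw [Real.mul_rpow (by positivity) hx, ← Real.rpow_mul hβ.le, mul_comm r]
  have hβa1 : β ^ (a + 1) = β ^ a * β := Real.rpow_add_one hβ.ne' a
  obtain ⟨z, rfl, hmin⟩ := hu.exists_apply_eq hinj (by positivity) hmem
  rw [add_sub_cancel_left, hαpow _ (norm_nonneg _), hαpow _ (norm_nonneg _)] at hmin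
  have hz₁E : β ^ (a + 1) * ‖z₁‖ ≤ E := by
    have h4 : β ^ a * (β * ‖z₁‖) ≤ β ^ a * (S * ψ β) :=
      mul_le_mul_of_nonneg_left hz₁norm (by positivity)
    have h5 : 0 ≤ (cb * C + C) * (ψ β * β ^ a) := by positivity
    rw [hβa1, hE, hK]
    linarith
  have hsum : ‖F (G z) - fδ‖ ^ r + (β ^ (a + 1) * ‖z - z₀‖) ^ r ≤ 2 * E ^ r := by
    have h4 : ‖F (G (z₀ + z₁)) - fδ‖ ^ r ≤ E ^ r := by gcongr
    have h5 : (β ^ (a + 1) * ‖z₁‖) ^ r ≤ E ^ r := by gcongr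
    linarith
  have hFu : ‖F (G z) - fδ‖ ≤ L * E :=
    hL ▸ le_mul_of_rpow_le hr (norm_nonneg _) hE0
      ((le_add_of_nonneg_right (by positivity)).trans hsum)
  have hzu : β ^ (a + 1) * ‖z - z₀‖ ≤ L * E :=
    hL ▸ le_mul_of_rpow_le hr (by positivity) hE0
      ((le_add_of_nonneg_left (by positivity)).trans hsum)
  have hFust : ‖F (G z) - fst‖ ≤ (L + 1) * E := by
    have h4 := norm_sub_le_norm_sub_add_norm_sub (F (G z)) fδ fst
    have h5 : 0 ≤ K * (ψ β * β ^ a) := by positivity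
    linarith
  have hc₁E : (L + 1) * E ≤ c₁ := by
    have h4 : (L + 1) * δ ≤ c₁ / 2 := by
      calc (L + 1) * δ ≤ (L + 1) * (c₁ / (2 * (L + 1))) := by gcongr
        _ = c₁ / 2 := by field_simp
    rw [hE]
    linarith
  have hweaku : ‖P (G z - ust)‖ ≤ (L + 1) / ca * E := by
    have h4 := (hlow _ ⟨hu.1, mem_scaleSpace_one.2 ⟨_, rfl⟩⟩ (hFust.trans hc₁E)).trans hFust
    rw [div_mul_eq_mul_div, le_div_iff₀ hca]
    linarith
  -- Interpolation for the difference of the minimizer and the auxiliary element.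
  have hweakE : ‖P (G (z₀ + z₁) - ust)‖ ≤ E := by
    have h5 : 0 ≤ (cb * C + S) * (ψ β * β ^ a) := by positivity
    rw [hE, hK]
    linarith
  have hPdiff : ‖P (G (z - (z₀ + z₁)))‖ ≤ ((L + 1) / ca + 1) * E := by
    have h4 : P (G (z - (z₀ + z₁))) = P (G z - ust) - P (G (z₀ + z₁) - ust) := by
      rw [← map_sub P, sub_sub_sub_cancel_right, map_sub G]
    rw [h4]
    linarith [norm_sub_le (P (G z - ust)) (P (G (z₀ + z₁) - ust))]
  have hzdiff : β * ‖z - (z₀ + z₁)‖ ≤ β ^ (-a) * ((L + 1) * E) := by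
    have h4 : ‖z - (z₀ + z₁)‖ ≤ ‖z - z₀‖ + ‖z₁‖ := by
      rw [← sub_sub]; exact norm_sub_le _ _
    have h5 : β ^ (a + 1) * ‖z - (z₀ + z₁)‖ ≤ (L + 1) * E := by
      calc β ^ (a + 1) * ‖z - (z₀ + z₁)‖ ≤ β ^ (a + 1) * (‖z - z₀‖ + ‖z₁‖) := by gcongr
        _ ≤ (L + 1) * E := by linarith
    calc β * ‖z - (z₀ + z₁)‖ = β ^ (-a) * (β ^ (a + 1) * ‖z - (z₀ + z₁)‖) := by
          rw [← mul_assoc, ← Real.rpow_add hβ, neg_add_cancel_left, Real.rpow_one]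
      _ ≤ _ := by gcongr
  have hinterp := hκ.norm_apply_le_interpolation hPapp hβ (z - (z₀ + z₁))
  rw [← hS'] at hinterp
  have hdiff : ‖G (z - (z₀ + z₁))‖ ≤ B * (β ^ (-a) * E) := by
    calc _ ≤ _ := hinterp
      _ ≤ S' * (1 + κ) * (β ^ (-a) * ((L + 1) * E)) +
          C * (β ^ (-a) * (((L + 1) / ca + 1) * E)) := by gcongr
      _ = _ := by rw [hB]; ring
  have hEβ : β ^ (-a) * E = K * ψ β + δ * β ^ (-a) := by
    have h4 : β ^ (-a) * β ^ a = 1 := by rw [← Real.rpow_add hβ, neg_add_cancel, Real.rpow_zero]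
    rw [hE]
    linear_combination K * ψ β * h4
  rw [hEβ] at hdiff
  have hfin : ‖G z - ust‖ ≤ ‖G (z - (z₀ + z₁))‖ + ‖G (z₀ + z₁) - ust‖ := by
    rw [map_sub]; exact norm_sub_le_norm_sub_add_norm_sub _ _ _
  have h8 : 0 ≤ δ * β ^ (-a) := by positivity
  have h9 : 0 ≤ (B * K + (1 + κ) ^ m) * (δ * β ^ (-a)) + B * ψ β := by positivity
  have : ‖G z - ust‖ ≤ (B * K + B + (1 + κ) ^ m) * (ψ β + δ * β ^ (-a)) := by linarith
  exact this

end ErrorEstimate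

/-! ### A priori parameter choices -/

section ParameterChoice

/-- The error estimate for an a priori parameter choice, where `β = α δ ^ kappa r a`. The initial
guess lies in the range of `G` and contributes the term `β` only. -/
theorem MainAssumption.exists_eventually_error_le {X Y Z : Type*} [NormedAddCommGroup X]
    [NormedSpace ℝ X] [CompleteSpace X] [NormedAddCommGroup Y] [NormedSpace ℝ Y]
    [NormedAddCommGroup Z] [NormedSpace ℝ Z] {e : X ≃ₗᵢ[ℝ] StrongDual ℝ Z} {G : X →L[ℝ] X}
    {F : X → Y} {DF : Set X} {ust : X} {fst : Y} {ubar : X} {a r κ : ℝ}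
    (h : MainAssumption e G F DF ust fst ubar a) (hκ : PositiveTypeWith G κ) (hr : 0 < r)
    {α : ℝ → ℝ} (hα : ∀ δ : ℝ, 0 < δ → 0 < α δ) (hα0 : Tendsto α (𝓝[>] 0) (𝓝 0))
    (hψ : Tendsto (fun β => ‖residual G β ust‖) (𝓝[>] 0) (𝓝 0)) :
    Tendsto (fun δ => α δ ^ kappa r a) (𝓝[>] 0) (𝓝[>] 0) ∧
    ∃ C : ℝ, 0 ≤ C ∧ ∀ᶠ δ in 𝓝[>] (0 : ℝ), ∀ fδ : Y, ‖fδ - fst‖ ≤ δ →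
      ∀ u : X, IsRegularizedSolution G F DF ubar r (α δ) fδ u →
        ‖u - ust‖ ≤ C * (‖residual G (α δ ^ kappa r a) ust‖ + α δ ^ kappa r a +
          δ / α δ ^ (kappa r a * a)) := by
  have ha := h.a_pos
  have hk : 0 < kappa r a := by rw [kappa]; positivity
  have hk1 : kappa r a * (r * (a + 1)) = 1 := by rw [kappa]; field_simp
  have hκ0 := hκ.pos
  have hβ : Tendsto (fun δ => α δ ^ kappa r a) (𝓝[>] 0) (𝓝[>] 0) := by
    refine tendsto_nhdsWithin_iff.2 ⟨?_, ?_⟩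
    · simpa [Real.zero_rpow hk.ne'] using hα0.rpow_const (Or.inr hk.le)
    · filter_upwards [self_mem_nhdsWithin] with δ hδ
      exact Real.rpow_pos_of_pos (hα δ hδ) _
  refine ⟨hβ, ?_⟩
  obtain ⟨z₀, hz₀⟩ := mem_scaleSpace_one.1 h.guess_mem.1
  have hsplit : ∀ β : ℝ, 0 < β →
      ‖residual G β (ust - ubar)‖ ≤ ‖residual G β ust‖ + (1 + κ) * ‖z₀‖ * β := by
    intro β hβ
    rw [map_sub, ← hz₀]
    exact (norm_sub_le _ _).trans
      (by linarith [hκ.norm_residual_apply_range_le hβ z₀])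
  have hψ' : Tendsto (fun β => ‖residual G β (ust - ubar)‖) (𝓝[>] 0) (𝓝 0) := by
    have h1 : Tendsto (fun β : ℝ => ‖residual G β ust‖ + (1 + κ) * ‖z₀‖ * β) (𝓝[>] 0) (𝓝 0) := by
      have h2 : Tendsto (fun β : ℝ => β) (𝓝[>] 0) (𝓝 0) :=
        tendsto_id.mono_left nhdsWithin_le_nhds
      simpa using hψ.add (h2.const_mul ((1 + κ) * ‖z₀‖))
    refine squeeze_zero' (Eventually.of_forall fun _ => norm_nonneg _) ?_ h1
    filter_upwards [self_mem_nhdsWithin] with β hβ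
    exact hsplit β hβ
  obtain ⟨C, δ₀, hC, hδ₀, hev⟩ := h.exists_error_le hκ hr hψ'
  refine ⟨C * (1 + (1 + κ) * ‖z₀‖), by positivity, ?_⟩
  have hle : ∀ᶠ δ : ℝ in 𝓝[>] 0, δ ≤ δ₀ :=
    mem_nhdsWithin_of_mem_nhds (Iic_mem_nhds hδ₀)
  filter_upwards [hβ.eventually hev, hle, self_mem_nhdsWithin] with δ h1 h2 hδ fδ hfδ u hu
  have hδ : 0 < δ := hδ
  have hαδ := hα δ hδ
  have hβ0 : 0 < α δ ^ kappa r a := by positivity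
  have h3 : (α δ ^ kappa r a) ^ (r * (a + 1)) = α δ := by
    rw [← Real.rpow_mul hαδ.le, hk1, Real.rpow_one]
  have h4 : δ * (α δ ^ kappa r a) ^ (-a) = δ / α δ ^ (kappa r a * a) := by
    rw [← Real.rpow_mul hαδ.le, mul_neg, Real.rpow_neg hαδ.le, div_eq_mul_inv]
  have h5 := h1 δ hδ h2 fδ hfδ u (by rwa [h3])
  rw [h4] at h5
  have h6 := hsplit _ hβ0
  have h7 : 0 ≤ δ / α δ ^ (kappa r a * a) := by positivity
  calc ‖u - ust‖ ≤ _ := h5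
    _ ≤ C * ((1 + (1 + κ) * ‖z₀‖) * (‖residual G (α δ ^ kappa r a) ust‖ + α δ ^ kappa r a +
          δ / α δ ^ (kappa r a * a))) := by
        gcongr
        have h8 : 0 ≤ α δ ^ kappa r a + (1 + κ) * ‖z₀‖ * (‖residual G (α δ ^ kappa r a) ust‖ +
          δ / α δ ^ (kappa r a * a)) := by positivity
        linarith
    _ = _ := by ring

lemma rpow_le_one_div_log {δ ε : ℝ} (hδ : 0 < δ) (hδ1 : δ < 1) (hε : 0 < ε) :
    δ ^ ε ≤ 1 / ε * (1 / Real.log (1 / δ)) := by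
  have hlog : 0 < Real.log (1 / δ) := Real.log_pos ((one_lt_div hδ).2 hδ1)
  have h1 := Real.log_le_rpow_div (by positivity : 0 ≤ 1 / δ) hε
  rw [one_div δ, Real.inv_rpow hδ.le, ← one_div δ] at h1
  rw [div_mul_div_comm, one_mul, le_div_iff₀ (by positivity)]
  have h2 : 0 < δ ^ ε := by positivity
  calc δ ^ ε * (ε * Real.log (1 / δ)) ≤ δ ^ ε * (ε * ((δ ^ ε)⁻¹ / ε)) := by gcongr
    _ = 1 := by field_simp

/-- Two-sided bounds extracted from `α ~ δ ^ b`. -/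
lemma exists_bounds_of_isTheta {α : ℝ → ℝ} {b : ℝ} (hα : ∀ δ : ℝ, 0 < δ → 0 < α δ)
    (h : α =Θ[𝓝[>] 0] fun δ : ℝ => δ ^ b) :
    ∃ c : ℝ, 0 < c ∧ ∀ᶠ δ in 𝓝[>] (0 : ℝ), α δ ≤ c * δ ^ b ∧ δ ^ b ≤ c * α δ := by
  obtain ⟨c₁, hc₁, h1⟩ := h.1.exists_pos
  obtain ⟨c₂, hc₂, h2⟩ := h.2.exists_pos
  refine ⟨c₁ + c₂, by positivity, ?_⟩
  filter_upwards [h1.bound, h2.bound, self_mem_nhdsWithin] with δ h1 h2 hδ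
  have hδ : 0 < δ := hδ
  have hαδ := hα δ hδ
  have hb : 0 < δ ^ b := by positivity
  rw [Real.norm_of_nonneg hαδ.le, Real.norm_of_nonneg hb.le] at h1 h2
  constructor <;> nlinarith

lemma tendsto_zero_of_isTheta {α : ℝ → ℝ} {b : ℝ} (hb : 0 < b)
    (h : α =Θ[𝓝[>] 0] fun δ : ℝ => δ ^ b) : Tendsto α (𝓝[>] 0) (𝓝 0) := by
  refine h.1.trans_tendsto ?_
  have h1 := (Real.continuousAt_rpow_const 0 b (Or.inr hb.le)).tendsto
  rw [Real.zero_rpow hb.ne'] at h1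
  exact h1.mono_left nhdsWithin_le_nhds

lemma div_rpow_le {x c δ b q : ℝ} (hδ : 0 < δ) (hx : 0 < x) (hq : 0 ≤ q)
    (h : δ ^ b ≤ c * x) : δ / x ^ q ≤ c ^ q * δ ^ (1 - b * q) := by
  have hc : 0 < c := pos_of_mul_pos_left ((Real.rpow_pos_of_pos hδ b).trans_le h) hx.le
  have h1 : δ ^ (b * q) ≤ c ^ q * x ^ q := by
    rw [Real.rpow_mul hδ.le, ← Real.mul_rpow hc.le hx.le]
    gcongr
  rw [Real.rpow_sub hδ, Real.rpow_one, div_le_iff₀ (by positivity)]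
  have h2 : 0 < δ ^ (b * q) := by positivity
  calc δ = δ / δ ^ (b * q) * δ ^ (b * q) := by field_simp
    _ ≤ δ / δ ^ (b * q) * (c ^ q * x ^ q) := by gcongr
    _ = _ := by ring

end ParameterChoice

end Oversmoothing

/-! ### Convergence and rates -/

theorem theorem3p2 {X Y Z : Type*}
    [NormedAddCommGroup X] [NormedSpace ℝ X] [CompleteSpace X]
    [NormedAddCommGroup Y] [NormedSpace ℝ Y] [CompleteSpace Y]
    [NormedAddCommGroup Z] [NormedSpace ℝ Z] [CompleteSpace Z] [TopologicalSpace.SeparableSpace Z]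
    (e : X ≃ₗᵢ[ℝ] StrongDual ℝ Z) (G : X →L[ℝ] X) (F : X → Y) (DF : Set X)
    (ust : X) (fst : Y) (ubar : X) (a r : ℝ)
    (h : MainAssumption e G F DF ust fst ubar a) (hr : 0 < r)
    (α : ℝ → ℝ) (hα : ∀ δ : ℝ, 0 < δ → 0 < α δ) :
    -- no explicit smoothness
    (ust ∈ closure (Set.range G) →
      Tendsto α (𝓝[>] 0) (𝓝 0) →
      Tendsto (fun δ : ℝ => δ / α δ ^ (kappa r a * a)) (𝓝[>] 0) (𝓝 0) →
      ∀ ε : ℝ, 0 < ε → ∀ᶠ δ in 𝓝[>] (0 : ℝ), ∀ fδ : Y, ‖fδ - fst‖ ≤ δ →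
        ∀ u : X, IsRegularizedSolution G F DF ubar r (α δ) fδ u → ‖u - ust‖ ≤ ε) ∧
    -- Hoelder smoothness
    (∀ p : ℝ, 0 < p → p ≤ 1 → ust ∈ scaleSpace G p →
      (α =Θ[𝓝[>] 0] fun δ : ℝ => δ ^ (1 / (kappa r a * (p + a)))) →
      ∃ C : ℝ, ∀ᶠ δ in 𝓝[>] (0 : ℝ), ∀ fδ : Y, ‖fδ - fst‖ ≤ δ →
        ∀ u : X, IsRegularizedSolution G F DF ubar r (α δ) fδ u →
          ‖u - ust‖ ≤ C * δ ^ (p / (p + a))) ∧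
    -- low order smoothness
    (a / (a + 1) < r → ust ∈ logDomain G →
      (α =Θ[𝓝[>] 0] fun δ : ℝ => δ) →
      ∃ C : ℝ, ∀ᶠ δ in 𝓝[>] (0 : ℝ), ∀ fδ : Y, ‖fδ - fst‖ ≤ δ →
        ∀ u : X, IsRegularizedSolution G F DF ubar r (α δ) fδ u →
          ‖u - ust‖ ≤ C * (1 / Real.log (1 / δ))) := by
  have ha := h.a_pos
  obtain ⟨κ, hκ⟩ := h.positive_type.exists_with
  have hk : 0 < kappa r a := by rw [kappa]; positivity
  refine ⟨fun hust hα0 hδα ε hε => ?_, fun p hp hp1 hust hΘ => ?_, fun hra hust hΘ => ?_⟩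
  · have hψ := hκ.tendsto_residual_of_mem_closure hust
    obtain ⟨hβ, C, hC, hev⟩ := h.exists_eventually_error_le hκ hr hα hα0 hψ
    have hlim := (((hψ.comp hβ).add (tendsto_nhds_of_tendsto_nhdsWithin hβ)).add hδα).const_mul C
    simp only [add_zero, mul_zero] at hlim
    filter_upwards [hev, hlim.eventually (gt_mem_nhds hε)] with δ h1 h2 fδ hfδ u hu
    exact (h1 fδ hfδ u hu).trans h2.le
  · set b : ℝ := 1 / (kappa r a * (p + a)) with hb
    have hb0 : 0 < b := by positivity
    obtain ⟨D, hD, hres⟩ := hκ.exists_norm_residual_le_of_mem_scaleSpace hp hp1 hust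
    have hψ : Tendsto (fun β => ‖residual G β ust‖) (𝓝[>] 0) (𝓝 0) := by
      have h1 : Tendsto (fun β : ℝ => D * β ^ p) (𝓝[>] 0) (𝓝 0) := by
        have h2 := (Real.continuousAt_rpow_const 0 p (Or.inr hp.le)).tendsto.const_mul D
        rw [Real.zero_rpow hp.ne', mul_zero] at h2
        exact h2.mono_left nhdsWithin_le_nhds
      refine squeeze_zero' (Eventually.of_forall fun _ => norm_nonneg _) ?_ h1
      filter_upwards [self_mem_nhdsWithin] with β hβ
      exact hres β hβ
    obtain ⟨hβ, C, hC, hev⟩ :=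
      h.exists_eventually_error_le hκ hr hα (tendsto_zero_of_isTheta hb0 hΘ) hψ
    obtain ⟨c, hc, hcb⟩ := exists_bounds_of_isTheta hα hΘ
    refine ⟨C * ((D + 1) * c ^ (kappa r a * p) + c ^ (kappa r a * a)), ?_⟩
    filter_upwards [hev, hcb, self_mem_nhdsWithin,
      (tendsto_nhds_of_tendsto_nhdsWithin hβ).eventually (gt_mem_nhds one_pos)]
      with δ h1 ⟨h2, h3⟩ hδ h4 fδ hfδ u hu
    have hδ : 0 < δ := hδ
    have hαδ := hα δ hδ
    have hβ0 : 0 < α δ ^ kappa r a := by positivity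
    have h5 : α δ ^ kappa r a ≤ (α δ ^ kappa r a) ^ p :=
      Real.self_le_rpow_of_le_one hβ0.le h4.le hp1
    have h6 : (α δ ^ kappa r a) ^ p ≤ c ^ (kappa r a * p) * δ ^ (p / (p + a)) := by
      have h7 : b * (kappa r a * p) = p / (p + a) := by rw [hb]; field_simp
      rw [← Real.rpow_mul hαδ.le, ← h7, Real.rpow_mul hδ.le,
        ← Real.mul_rpow hc.le (by positivity)]
      gcongr
    have h8 : δ / α δ ^ (kappa r a * a) ≤ c ^ (kappa r a * a) * δ ^ (p / (p + a)) := by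
      have h9 : 1 - b * (kappa r a * a) = p / (p + a) := by rw [hb]; field_simp; ring
      rw [← h9]
      exact div_rpow_le hδ hαδ (by positivity) h3
    calc ‖u - ust‖ ≤ _ := h1 fδ hfδ u hu
      _ ≤ C * ((D + 1) * (c ^ (kappa r a * p) * δ ^ (p / (p + a))) +
            c ^ (kappa r a * a) * δ ^ (p / (p + a))) := by
          have h10 : D * (α δ ^ kappa r a) ^ p ≤
            D * (c ^ (kappa r a * p) * δ ^ (p / (p + a))) := by gcongr
          gcongr
          linarith [hres _ hβ0]
      _ = _ := by ring
  · have hΘ' : α =Θ[𝓝[>] 0] fun δ : ℝ => δ ^ (1 : ℝ) := by simpa using hΘ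
    obtain ⟨D, hD, hres⟩ := hκ.exists_norm_residual_le_of_mem_logDomain hust
    have hlog : Tendsto (fun β : ℝ => Real.log (1 / β)) (𝓝[>] 0) atTop := by
      simp only [one_div]
      exact Real.tendsto_log_atTop.comp tendsto_inv_nhdsGT_zero
    have hψ : Tendsto (fun β => ‖residual G β ust‖) (𝓝[>] 0) (𝓝 0) :=
      squeeze_zero' (Eventually.of_forall fun _ => norm_nonneg _) hres (hlog.const_div_atTop D)
    obtain ⟨hβ, C, hC, hev⟩ :=
      h.exists_eventually_error_le hκ hr hα (tendsto_zero_of_isTheta one_pos hΘ') hψ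
    obtain ⟨c, hc, hcb⟩ := exists_bounds_of_isTheta hα hΘ'
    have hka : 0 < 1 - kappa r a * a := by
      rw [div_lt_iff₀ (by positivity)] at hra
      rw [kappa, sub_pos, one_div_mul_eq_div, div_lt_one (by positivity)]
      exact hra
    have hhalf : 0 < kappa r a / 2 := by positivity
    refine ⟨C * (2 * D / kappa r a + 1 / (kappa r a / 2) +
      c ^ (kappa r a * a) * (1 / (1 - kappa r a * a))), ?_⟩
    have hsqrt : ∀ᶠ δ : ℝ in 𝓝[>] 0, c * δ ^ (1 / 2 : ℝ) < 1 := by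
      have h2 := (Real.continuousAt_rpow_const 0 (1 / 2 : ℝ)
        (Or.inr (by norm_num))).tendsto.const_mul c
      rw [Real.zero_rpow (by norm_num), mul_zero] at h2
      exact (h2.mono_left nhdsWithin_le_nhds).eventually (gt_mem_nhds one_pos)
    have hlt1 : ∀ᶠ δ : ℝ in 𝓝[>] 0, δ < 1 := mem_nhdsWithin_of_mem_nhds (gt_mem_nhds one_pos)
    filter_upwards [hev, hcb, hβ.eventually hres, hsqrt, hlt1, self_mem_nhdsWithin]
      with δ h1 ⟨h2, h3⟩ h4 h5 hδ1 hδ fδ hfδ u hu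
    have hδ : 0 < δ := hδ
    have hαδ := hα δ hδ
    have hlogδ : 0 < Real.log (1 / δ) := Real.log_pos ((one_lt_div hδ).2 hδ1)
    -- `α ≤ c δ` is used in the weaker form `α ≤ δ ^ (1 / 2)`, free of constants.
    have h6 : α δ ≤ δ ^ (1 / 2 : ℝ) := by
      have h7 : δ ^ (1 : ℝ) = δ ^ (1 / 2 : ℝ) * δ ^ (1 / 2 : ℝ) := by
        rw [← Real.rpow_add hδ]; norm_num
      rw [h7, ← mul_assoc] at h2
      exact h2.trans (mul_le_of_le_one_left (by positivity) h5.le)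
    have h7 : α δ ^ kappa r a ≤ δ ^ (kappa r a / 2) := by
      calc α δ ^ kappa r a ≤ (δ ^ (1 / 2 : ℝ)) ^ kappa r a := by gcongr
        _ = δ ^ (kappa r a / 2) := by rw [← Real.rpow_mul hδ.le]; congr 1; ring
    have h8 : kappa r a / 2 * Real.log (1 / δ) ≤ Real.log (1 / α δ ^ kappa r a) := by
      have h9 := Real.log_le_log (by positivity) h7
      rw [Real.log_rpow hδ] at h9
      rw [one_div, one_div, Real.log_inv, Real.log_inv]
      linarith
    have h9 : ‖residual G (α δ ^ kappa r a) ust‖ ≤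
        2 * D / kappa r a * (1 / Real.log (1 / δ)) := by
      calc _ ≤ _ := h4
        _ ≤ D / (kappa r a / 2 * Real.log (1 / δ)) := by gcongr
        _ = _ := by field_simp
    have h10 := h7.trans (rpow_le_one_div_log hδ hδ1 hhalf)
    have h11 : δ / α δ ^ (kappa r a * a) ≤
        c ^ (kappa r a * a) * (1 / (1 - kappa r a * a) * (1 / Real.log (1 / δ))) := by
      refine (div_rpow_le hδ hαδ (by positivity) h3).trans ?_
      rw [one_mul]
      gcongr
      exact rpow_le_one_div_log hδ hδ1 hka
    calc ‖u - ust‖ ≤ _ := h1 fδ hfδ u hu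
      _ ≤ C * (2 * D / kappa r a * (1 / Real.log (1 / δ)) +
            1 / (kappa r a / 2) * (1 / Real.log (1 / δ)) +
            c ^ (kappa r a * a) * (1 / (1 - kappa r a * a) * (1 / Real.log (1 / δ)))) := by
          gcongr
      _ = _ := by ring
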